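/- Let $\mathbb{R}_+=(0,\infty)$ and let $L^2(\mathbb{R}_+)$ be the complex Hilbert space of square-integrable functions. For $\tau\in\mathbb{R}$ put $$c(\tau)=2^{i\tau/2}\,\frac{\Gamma(\frac14+\frac{i\tau}{2})}{|\Gamma(\frac14+\frac{i\tau}{2})|},\qquad s(\tau)=2^{i\tau/2}\,\frac{\Gamma(\frac34+\frac{i\tau}{2})}{|\Gamma(\frac34+\frac{i\tau}{2})|},$$ and for $t,\tau>0$ $$e_c^{+}(t,\tau)=\tfrac{1}{2\sqrt\pi}\bigl(t^{-\frac12-i\tau}c(\tau)+t^{-\frac12+i\tau}c(-\tau)\bigr),\qquad e_c^{-}(t,\tau)=\tfrac{1}{2i\sqrt\pi}\bigl(t^{-\frac12-i\tau}c(\tau)-t^{-\frac12+i\tau}c(-\tau)\bigr),$$ $$e_s^{+}(t,\tau)=\tfrac{1}{2\sqrt\pi}\bigl(t^{-\frac12-i\tau}s(\tau)+t^{-\frac12+i\tau}s(-\tau)\bigr),\qquad e_s^{-}(t,\tau)=\tfrac{1}{2i\sqrt\pi}\bigl(t^{-\frac12-i\tau}s(\tau)-t^{-\frac12+i\tau}s(-\tau)\bigr).$$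 Each of the six integral transforms, defined for $\phi\in L^1(\mathbb{R}_+)\cap L^2(\mathbb{R}_+)$ and $t>0$ by $$(\mathscr{C}\phi)(t)=\sqrt{\tfrac2\pi}\int_0^\infty\cos(t\xi)\phi(\xi)\,d\xi,\qquad(\mathscr{S}\phi)(t)=\sqrt{\tfrac2\pi}\int_0^\infty\sin(t\xi)\phi(\xi)\,d\xi,$$ $$(\mathscr{T}_c^{\pm}\phi)(t)=\int_0^\infty e_c^{\pm}(t,\tau)\phi(\tau)\,d\tau,\qquad(\mathscr{T}_s^{\pm}\phi)(t)=\int_0^\infty e_s^{\pm}(t,\tau)\phi(\tau)\,d\tau,$$ extends uniquely to a linear isometry of $L^2(\mathbb{R}_+)$ into itself, denoted by the same letter, and: 1. the range of $\mathscr{T}_c^{+}$ is $\mathcal{C}_{+1}=\{x\in L^2(\mathbb{R}_+):\mathscr{C}x=x\}$; 2. the range of $\mathscr{T}_c^{-}$ is $\mathcal{C}_{-1}=\{x\in L^2(\mathbb{R}_+):\mathscr{C}x=-x\}$; 3. the range of $\mathscr{T}_s^{+}$ is $\mathcal{S}_{+1}=\{x\in L^2(\mathbb{R}_+):\mathscr{S}x=x\}$;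 4. the range of $\mathscr{T}_s^{-}$ is $\mathcal{S}_{-1}=\{x\in L^2(\mathbb{R}_+):\mathscr{S}x=-x\}$. -/

import Mathlib

noncomputable section

/-- Lebesgue measure on the positive half-axis `ℝ₊ = (0, ∞)`. -/
abbrev halfLineMeasure : MeasureTheory.Measure ℝ :=
  MeasureTheory.volume.restrict (Set.Ioi (0 : ℝ))

/-- The complex Hilbert space `L²(ℝ₊)`. -/
abbrev L2HalfLine : Type := MeasureTheory.Lp ℂ 2 halfLineMeasure

/-- The integral transform `φ ↦ ∫_{ℝ₊} k(t, τ) φ(τ) dτ` with kernel `k`. -/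
def kernelTransform (k : ℝ → ℝ → ℂ) (φ : ℝ → ℂ) (t : ℝ) : ℂ :=
  ∫ τ in Set.Ioi (0 : ℝ), k t τ * φ τ

/-- `A` is an isometric operator on the whole of `L²(ℝ₊)` which acts on
`L¹(ℝ₊) ∩ L²(ℝ₊)` as the integral transform with kernel `k`. -/
def IsIsometricExtension (k : ℝ → ℝ → ℂ) (A : L2HalfLine →L[ℂ] L2HalfLine) : Prop :=
  Isometry A ∧
    ∀ φ : L2HalfLine, MeasureTheory.Integrable φ halfLineMeasure →
      A φ =ᵐ[halfLineMeasure] kernelTransform k φ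

open Classical in
/-- The isometric extension to `L²(ℝ₊)` of the integral transform with kernel `k`
(and `0` if there is no such extension). -/
def isometricExtension (k : ℝ → ℝ → ℂ) : L2HalfLine →L[ℂ] L2HalfLine :=
  if h : ∃ A, IsIsometricExtension k A then h.choose else 0

/-- The kernel of the cosine transform. -/
def cosineKernel (t ξ : ℝ) : ℂ := ((Real.sqrt (2 / Real.pi) * Real.cos (t * ξ) : ℝ) : ℂ)

/-- The kernel of the sine transform. -/
def sineKernel (t ξ : ℝ) : ℂ := ((Real.sqrt (2 / Real.pi) * Real.sin (t * ξ) : ℝ) : ℂ)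

/-- The cosine transform on `L²(ℝ₊)`. -/
def cosineTransform : L2HalfLine →L[ℂ] L2HalfLine := isometricExtension cosineKernel

/-- The sine transform on `L²(ℝ₊)`. -/
def sineTransform : L2HalfLine →L[ℂ] L2HalfLine := isometricExtension sineKernel

/-- `exp (i arg Γ(ζ)) = Γ(ζ) / |Γ(ζ)|`. -/
def gammaPhase (ζ : ℂ) : ℂ := Complex.Gamma ζ / (‖Complex.Gamma ζ‖ : ℂ)

/-- The phase factor `c(τ) = 2^{iτ/2} exp (i arg Γ(1/4 + iτ/2))`. -/
def phaseC (τ : ℝ) : ℂ :=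
  (2 : ℂ) ^ (Complex.I * (τ / 2)) * gammaPhase (1 / 4 + Complex.I * (τ / 2))

/-- The phase factor `s(τ) = 2^{iτ/2} exp (i arg Γ(3/4 + iτ/2))`. -/
def phaseS (τ : ℝ) : ℂ :=
  (2 : ℂ) ^ (Complex.I * (τ / 2)) * gammaPhase (3 / 4 + Complex.I * (τ / 2))

/-- The generalized eigenfunction `e_c⁺(t, τ)` of the cosine transform. -/
def eCPlus (t τ : ℝ) : ℂ :=
  1 / (2 * (Real.sqrt Real.pi : ℂ)) *
    ((t : ℂ) ^ (-(1 / 2) - Complex.I * τ : ℂ) * phaseC τ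
      + (t : ℂ) ^ (-(1 / 2) + Complex.I * τ : ℂ) * phaseC (-τ))

/-- The generalized eigenfunction `e_c⁻(t, τ)` of the cosine transform. -/
def eCMinus (t τ : ℝ) : ℂ :=
  1 / (2 * Complex.I * (Real.sqrt Real.pi : ℂ)) *
    ((t : ℂ) ^ (-(1 / 2) - Complex.I * τ : ℂ) * phaseC τ
      - (t : ℂ) ^ (-(1 / 2) + Complex.I * τ : ℂ) * phaseC (-τ))

/-- The generalized eigenfunction `e_s⁺(t, τ)` of the sine transform. -/
def eSPlus (t τ : ℝ) : ℂ :=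
  1 / (2 * (Real.sqrt Real.pi : ℂ)) *
    ((t : ℂ) ^ (-(1 / 2) - Complex.I * τ : ℂ) * phaseS τ
      + (t : ℂ) ^ (-(1 / 2) + Complex.I * τ : ℂ) * phaseS (-τ))

/-- The generalized eigenfunction `e_s⁻(t, τ)` of the sine transform. -/
def eSMinus (t τ : ℝ) : ℂ :=
  1 / (2 * Complex.I * (Real.sqrt Real.pi : ℂ)) *
    ((t : ℂ) ^ (-(1 / 2) - Complex.I * τ : ℂ) * phaseS τ
      - (t : ℂ) ^ (-(1 / 2) + Complex.I * τ : ℂ) * phaseS (-τ))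

/-- The operator `T_c⁺` on `L²(ℝ₊)`. -/
def transformCPlus : L2HalfLine →L[ℂ] L2HalfLine := isometricExtension eCPlus

/-- The operator `T_c⁻` on `L²(ℝ₊)`. -/
def transformCMinus : L2HalfLine →L[ℂ] L2HalfLine := isometricExtension eCMinus

/-- The operator `T_s⁺` on `L²(ℝ₊)`. -/
def transformSPlus : L2HalfLine →L[ℂ] L2HalfLine := isometricExtension eSPlus

/-- The operator `T_s⁻` on `L²(ℝ₊)`. -/
def transformSMinus : L2HalfLine →L[ℂ] L2HalfLine := isometricExtension eSMinus

/-- The subspace `{x ∈ L²(ℝ₊) : A x = μ x}`. -/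
def eigensubspace (A : L2HalfLine →L[ℂ] L2HalfLine) (μ : ℂ) : Submodule ℂ L2HalfLine :=
  Module.End.eigenspace (A : L2HalfLine →ₗ[ℂ] L2HalfLine) μ

/-- The range of values of an operator on `L²(ℝ₊)`. -/
def operatorRange (A : L2HalfLine →L[ℂ] L2HalfLine) : Submodule ℂ L2HalfLine :=
  LinearMap.range (A : L2HalfLine →ₗ[ℂ] L2HalfLine)

end

/-!
All six kernels are folded Fourier kernels: `k(t, τ) = A(t) (e^{-iτξ(t)} w(τ) + e^{iτξ(t)} w(-τ))`
with `|w| = 1`, where `ξ(t) = t` for the cosine and sine kernels and `ξ(t) = log t` for `e^±`. The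
transform of `φ` is then, up to `A`, the Fourier transform of `w(τ) φ(|τ|)` on `ℝ` evaluated at
`ξ(t) / 2π`, so Plancherel's theorem shows that the `L²` norm is preserved on `L¹ ∩ L²`
(`IsFoldedFourierKernel.existsUnique`), and such a transform extends uniquely by density
(`existsUnique_isIsometricExtension`).

The spectral part avoids the functional equation of `Γ` and all conditionally convergent integrals
by using Gaussians. Let `ν = 1/4` in the cosine case and `ν = 3/4` in the sine case. The dilated
profiles `P_b(t) = e^{2νb} t^{2ν-1/2} exp(-e^{2b} t²/2)` are mapped by the cosine or sine transform
`K` to `P_{-b}`. The Mellin transform of a Gaussian is a Gamma function, so Mellin inversion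
(`integral_exp_mul_mellinPhase`) shows that `T^+` maps `|Γ(ν + iτ/2)| cos(bτ)` to a multiple of
`P_b + P_{-b}`, and `T^-` maps `|Γ(ν + iτ/2)| sin(bτ)` to a multiple of `P_b - P_{-b}`
(`transformPlus_cosineTest`, `transformMinus_sineTest`). Hence `K T^± = ±T^±` on these functions.
They are total in `L²(ℝ₊)`: orthogonality of `φ` to all of them says that the cosine or sine
transform of `|Γ| φ` vanishes, and these transforms are isometric while `Γ` has no zeros
(`eq_zero_of_inner_test`). So `K T^± = ±T^±` everywhere.

Conversely, the ranges of `T^+` and `T^-` together contain all `P_b`, which are total by Weierstrass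
approximation in the variable `e^{-t²/2}` (`eq_zero_of_inner_profileLp`). If `K x = x`, the
component `v` of `x` orthogonal to the range of `T^+` also satisfies `K v = v`; since `K` is isometric and is
`-1` on the range of `T^-`, the vector `v` is orthogonal to that range too, so `v = 0`
(`range_eq_eigenspace`). The eigenvalue `-1` is symmetric.
-/

open MeasureTheory Set Filter Topology FourierTransform
open scoped ENNReal Real

noncomputable section

/-! ### Plancherel's theorem on `L¹ ∩ L²` -/

/-- On `L¹ ∩ L²` the Fourier integral represents the `L²` Fourier transform. -/
theorem fourier_ae_eq_fourier_toLp {h : ℝ → ℂ} (h1 : Integrable h) (h2 : MemLp h 2) :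
    𝓕 h =ᵐ[volume] (𝓕 (h2.toLp h) : Lp ℂ 2 (volume : Measure ℝ)) := by
  have hcont : Continuous (𝓕 h) :=
    VectorFourier.fourierIntegral_continuous Real.continuous_fourierChar continuous_inner h1
  refine ae_eq_of_integral_contDiff_smul_eq hcont.locallyIntegrable
    ((Lp.memLp _).locallyIntegrable one_le_two) fun g hg hgs ↦ ?_
  have hgs' : HasCompactSupport (fun x ↦ (g x : ℂ)) := hgs.comp_left (g := Complex.ofReal) rfl
  let G : SchwartzMap ℝ ℂ := hgs'.toSchwartzMap (Complex.ofRealCLM.contDiff.comp hg)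
  have hG (x : ℝ) : G x = (g x : ℂ) := rfl
  have key := DFunLike.congr_fun (Lp.fourier_toTemperedDistribution_eq (h2.toLp h)) G
  rw [TemperedDistribution.fourier_apply, Lp.toTemperedDistribution_apply,
    Lp.toTemperedDistribution_apply] at key
  have hsw : ∫ x, (𝓕 (G : ℝ → ℂ)) x • h x = ∫ x, G x • (𝓕 h) x := by
    have := VectorFourier.integral_fourierIntegral_smul_eq_flip (μ := volume) (ν := volume)
      (L := innerₗ ℝ) (f := (G : ℝ → ℂ)) (g := h) Real.continuous_fourierChar
      continuous_inner G.integrable h1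
    rw [flip_innerₗ] at this
    exact this
  have e1 : ∫ x, (𝓕 G) x • (h2.toLp h) x = ∫ x, (𝓕 (G : ℝ → ℂ)) x • h x := by
    refine integral_congr_ae ?_
    filter_upwards [h2.coeFn_toLp] with x hx
    rw [hx, SchwartzMap.fourier_coe]
  rw [e1, hsw] at key
  simpa [hG] using key

/-- Plancherel's theorem on `L¹ ∩ L²`. -/
theorem eLpNorm_fourier {h : ℝ → ℂ} (h1 : Integrable h) (h2 : MemLp h 2) :
    eLpNorm (𝓕 h) 2 = eLpNorm h 2 := by
  rw [eLpNorm_congr_ae (fourier_ae_eq_fourier_toLp h1 h2), ← Lp.enorm_def,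
    ← eLpNorm_congr_ae h2.coeFn_toLp, ← Lp.enorm_def, ← ofReal_norm, ← ofReal_norm,
    Lp.norm_fourier_eq]

theorem eLpNorm_two_sq {α : Type*} [MeasurableSpace α] (μ : Measure α) (f : α → ℂ) :
    eLpNorm f 2 μ ^ (2 : ℝ) = ∫⁻ x, ‖f x‖ₑ ^ (2 : ℝ) ∂μ := by
  simpa using eLpNorm_nnreal_pow_eq_lintegral (f := f) (μ := μ) (p := 2) two_ne_zero

theorem eLpNorm_two_eq_iff {α β : Type*} [MeasurableSpace α] [MeasurableSpace β]
    {μ : Measure α} {ν : Measure β} {f : α → ℂ} {g : β → ℂ} :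
    eLpNorm f 2 μ = eLpNorm g 2 ν ↔
      ∫⁻ x, ‖f x‖ₑ ^ (2 : ℝ) ∂μ = ∫⁻ x, ‖g x‖ₑ ^ (2 : ℝ) ∂ν := by
  rw [← eLpNorm_two_sq, ← eLpNorm_two_sq]
  exact (ENNReal.rpow_left_injective two_ne_zero).eq_iff.symm

theorem lintegral_fourier {h : ℝ → ℂ} (h1 : Integrable h) (h2 : MemLp h 2) :
    ∫⁻ x, ‖𝓕 h x‖ₑ ^ (2 : ℝ) = ∫⁻ x, ‖h x‖ₑ ^ (2 : ℝ) :=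
  eLpNorm_two_eq_iff.1 (eLpNorm_fourier h1 h2)

/-! ### Extension of norm-preserving integral transforms -/

/-- The subspace `L¹ ∩ L²` of `L²(ℝ₊)`. -/
def integrableSubspace : Submodule ℂ L2HalfLine where
  carrier := {φ | Integrable φ halfLineMeasure}
  add_mem' {φ ψ} hφ hψ := (hφ.add hψ).congr (Lp.coeFn_add φ ψ).symm
  zero_mem' := (integrable_zero _ _ _).congr (Lp.coeFn_zero _ _ _).symm
  smul_mem' c φ hφ := (hφ.smul c).congr (Lp.coeFn_smul c φ).symm

theorem dense_integrableSubspace : Dense (integrableSubspace : Set L2HalfLine) := by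
  refine (Lp.simpleFunc.dense (p := 2) (μ := halfLineMeasure) (E := ℂ)
    ENNReal.ofNat_ne_top).mono fun φ hφ ↦ ?_
  have h2 := Lp.simpleFunc.memLp ⟨φ, hφ⟩
  have : MemLp (Lp.simpleFunc.toSimpleFunc ⟨φ, hφ⟩) 1 halfLineMeasure :=
    (SimpleFunc.memLp_iff (p := 1) one_ne_zero ENNReal.one_ne_top).2
      ((SimpleFunc.memLp_iff two_ne_zero ENNReal.ofNat_ne_top).1 h2)
  exact (memLp_one_iff_integrable.1 this).congr (Lp.simpleFunc.toSimpleFunc_eq_toFun ⟨φ, hφ⟩)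

theorem ext_of_eqOn_integrableSubspace {A B : L2HalfLine →L[ℂ] L2HalfLine}
    (h : ∀ φ : L2HalfLine, Integrable φ halfLineMeasure → A φ = B φ) : A = B :=
  DFunLike.coe_injective (A.continuous.ext_on dense_integrableSubspace B.continuous h)

theorem kernelTransform_congr {k : ℝ → ℝ → ℂ} {φ ψ : ℝ → ℂ} (h : φ =ᵐ[halfLineMeasure] ψ) :
    kernelTransform k φ = kernelTransform k ψ := by
  ext t
  exact integral_congr_ae (h.mono fun τ hτ ↦ by simp only [hτ])

/-- An integral transform with kernel bounded in the second variable which preserves the `L²` norm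
on `L¹ ∩ L²` has exactly one isometric extension to `L²(ℝ₊)`. -/
theorem existsUnique_isIsometricExtension {k : ℝ → ℝ → ℂ}
    (hk : ∀ t, 0 < t → AEStronglyMeasurable (k t) halfLineMeasure)
    (hb : ∀ t, 0 < t → ∃ C, ∀ τ, 0 < τ → ‖k t τ‖ ≤ C)
    (hiso : ∀ φ : ℝ → ℂ, Integrable φ halfLineMeasure → MemLp φ 2 halfLineMeasure →
      MemLp (kernelTransform k φ) 2 halfLineMeasure ∧
        eLpNorm (kernelTransform k φ) 2 halfLineMeasure = eLpNorm φ 2 halfLineMeasure) :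
    ∃! A, IsIsometricExtension k A := by
  have hint {φ : ℝ → ℂ} (hφ : Integrable φ halfLineMeasure) {t : ℝ} (ht : 0 < t) :
      Integrable (fun τ ↦ k t τ * φ τ) halfLineMeasure := by
    obtain ⟨C, hC⟩ := hb t ht
    exact hφ.bdd_mul (hk t ht) ((ae_restrict_mem measurableSet_Ioi).mono hC)
  have hS (φ : integrableSubspace) :=
    hiso φ.1 φ.2 (Lp.memLp φ.1)
  let T : integrableSubspace →ₗ[ℂ] L2HalfLine :=
    { toFun := fun φ ↦ (hS φ).1.toLp _
      map_add' := fun φ ψ ↦ by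
        rw [← MemLp.toLp_add]
        refine MemLp.toLp_congr _ _ ?_
        filter_upwards [ae_restrict_mem measurableSet_Ioi] with t ht
        rw [Submodule.coe_add, kernelTransform_congr (Lp.coeFn_add φ.1 ψ.1)]
        simp only [kernelTransform, Pi.add_apply, mul_add]
        exact integral_add (hint φ.2 ht) (hint ψ.2 ht)
      map_smul' := fun c φ ↦ by
        rw [RingHom.id_apply, ← MemLp.toLp_const_smul]
        refine MemLp.toLp_congr _ _ (Eventually.of_forall fun t ↦ ?_)
        rw [Submodule.coe_smul, kernelTransform_congr (Lp.coeFn_smul c φ.1)]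
        simp only [kernelTransform, Pi.smul_apply, smul_eq_mul, ← integral_const_mul]
        congr 1; ext τ; ring }
  have hTn (φ : integrableSubspace) : ‖T φ‖ = ‖(φ : L2HalfLine)‖ := by
    simp only [T, LinearMap.coe_mk, AddHom.coe_mk]
    rw [Lp.norm_toLp, (hS φ).2, Lp.norm_def]
  have hdense : DenseRange integrableSubspace.subtype := by
    rw [DenseRange]
    simpa using dense_integrableSubspace
  have hbd : ∃ C, ∀ φ, ‖T φ‖ ≤ C * ‖integrableSubspace.subtype φ‖ :=
    ⟨1, fun φ ↦ by rw [one_mul, hTn]; rfl⟩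
  let A : L2HalfLine →L[ℂ] L2HalfLine := T.extendOfNorm integrableSubspace.subtype
  have hA (φ : integrableSubspace) : A φ.1 = T φ := T.extendOfNorm_eq hdense hbd φ
  refine ⟨A, ⟨?_, fun φ hφ ↦ ?_⟩, fun B hB ↦ ?_⟩
  · refine AddMonoidHomClass.isometry_of_norm A fun φ ↦ ?_
    refine hdense.induction_on (p := fun φ ↦ ‖A φ‖ = ‖φ‖) φ
      (isClosed_eq (by fun_prop) (by fun_prop)) fun φ ↦ ?_
    exact (congrArg norm (hA φ)).trans (hTn φ)
  · rw [show A φ = T ⟨φ, hφ⟩ from hA ⟨φ, hφ⟩]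
    exact MemLp.coeFn_toLp (hS ⟨φ, hφ⟩).1
  · refine ext_of_eqOn_integrableSubspace fun φ hφ ↦ ?_
    rw [show A φ = T ⟨φ, hφ⟩ from hA ⟨φ, hφ⟩]
    exact Lp.ext ((hB.2 φ hφ).trans (MemLp.coeFn_toLp (hS ⟨φ, hφ⟩).1).symm)

/-! ### Folded Fourier kernels -/

theorem lintegral_eq_lintegral_Ioi_add (F : ℝ → ℝ≥0∞) :
    ∫⁻ x, F x = (∫⁻ x in Ioi 0, F x) + ∫⁻ x in Ioi 0, F (-x) := by
  rw [← lintegral_add_compl F (measurableSet_Ioi (a := (0 : ℝ))), compl_Ioi,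
    ← setLIntegral_congr Iio_ae_eq_Iic]
  congr 1
  have := (Measure.measurePreserving_neg (volume : Measure ℝ)).setLIntegral_comp_preimage_emb
    (Homeomorph.neg ℝ).measurableEmbedding F (Iio 0)
  rw [← this]
  simp

theorem integral_eq_integral_Ioi_add {G : ℝ → ℂ} (hG : Integrable G) :
    ∫ x, G x = ∫ x in Ioi (0 : ℝ), (G x + G (-x)) := by
  rw [integral_add hG.integrableOn hG.comp_neg.integrableOn, integral_comp_neg_Ioi, neg_zero,
    ← integral_add_compl (measurableSet_Ioi (a := (0 : ℝ))) hG, compl_Ioi]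

theorem measurePreserving_abs :
    MeasurePreserving (fun x : ℝ ↦ |x|) volume ((2 : ℝ≥0∞) • halfLineMeasure) := by
  refine ⟨continuous_abs.measurable, Measure.ext fun s hs ↦ ?_⟩
  have hs' : MeasurableSet ((fun x : ℝ ↦ |x|) ⁻¹' s) := continuous_abs.measurable hs
  have hi (x : ℝ) : ((fun x : ℝ ↦ |x|) ⁻¹' s).indicator (1 : ℝ → ℝ≥0∞) x = s.indicator 1 |x| := rfl
  rw [Measure.map_apply continuous_abs.measurable hs, ← lintegral_indicator_one hs',
    lintegral_eq_lintegral_Ioi_add, Measure.smul_apply, smul_eq_mul, two_mul,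
    ← lintegral_indicator_one hs]
  congr 1 <;> refine setLIntegral_congr_fun measurableSet_Ioi fun x hx ↦ ?_ <;>
    simp [hi, abs_of_pos (mem_Ioi.1 hx)]

theorem memLp_mul_comp_abs {w : ℝ → ℂ} (hw : Measurable w) (hw1 : ∀ τ, ‖w τ‖ = 1) {φ : ℝ → ℂ}
    {p : ℝ≥0∞} (hφ : MemLp φ p halfLineMeasure) :
    MemLp (fun τ ↦ w τ * φ |τ|) p := by
  have h : MemLp (fun τ : ℝ ↦ φ |τ|) p :=
    (hφ.smul_measure ENNReal.ofNat_ne_top).comp_measurePreserving measurePreserving_abs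
  refine (memLp_congr_norm (hw.aestronglyMeasurable.mul h.1) h.1
    (Eventually.of_forall fun τ ↦ ?_)).2 h
  simp [hw1]

theorem lintegral_mul_comp_abs {w : ℝ → ℂ} (hw1 : ∀ τ, ‖w τ‖ = 1) (φ : ℝ → ℂ) :
    ∫⁻ τ, ‖w τ * φ |τ|‖ₑ ^ (2 : ℝ) = 2 * ∫⁻ τ in Ioi 0, ‖φ τ‖ₑ ^ (2 : ℝ) := by
  have hw' (τ) : ‖w τ‖ₑ = 1 := by rw [← ofReal_norm, hw1, ENNReal.ofReal_one]
  rw [lintegral_eq_lintegral_Ioi_add, two_mul]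
  congr 1 <;> refine setLIntegral_congr_fun measurableSet_Ioi fun x hx ↦ ?_ <;>
    simp [abs_of_pos (mem_Ioi.1 hx), enorm_mul, hw']

theorem fourier_div_two_pi (h : ℝ → ℂ) (y : ℝ) :
    𝓕 h (y / (2 * π)) = ∫ τ : ℝ, Complex.exp (-(Complex.I * τ * y)) * h τ := by
  rw [Real.fourier_real_eq_integral_exp_smul]
  congr 1
  ext τ
  rw [show (-2 * π * τ * (y / (2 * π)) : ℝ) = -(τ * y) by field_simp, smul_eq_mul]
  congr 2
  push_cast
  ring

theorem norm_exp_neg_I_mul (τ y : ℝ) : ‖Complex.exp (-(Complex.I * τ * y))‖ = 1 := by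
  rw [show -(Complex.I * τ * y) = ((-(τ * y) : ℝ) : ℂ) * Complex.I by push_cast; ring,
    Complex.norm_exp_ofReal_mul_I]

theorem integrable_exp_neg_I_mul {h : ℝ → ℂ} (hh : Integrable h) (y : ℝ) :
    Integrable fun τ : ℝ ↦ Complex.exp (-(Complex.I * τ * y)) * h τ :=
  hh.bdd_mul (c := 1) (by fun_prop) (Eventually.of_forall fun τ ↦ (norm_exp_neg_I_mul τ y).le)

/-- The kernel `k` is obtained by folding `A(t) e^{-iτξ(t)} w(τ)` from `τ ∈ ℝ` to `τ > 0`. All six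
kernels are of this form, with `w` unimodular. -/
def IsFoldedFourierKernel (k : ℝ → ℝ → ℂ) (A ξ : ℝ → ℝ) (w : ℝ → ℂ) : Prop :=
  ∀ t τ, 0 < t → 0 < τ → k t τ = A t * (Complex.exp (-(Complex.I * τ * ξ t)) * w τ
    + Complex.exp (Complex.I * τ * ξ t) * w (-τ))

section folded

variable {k : ℝ → ℝ → ℂ} {A ξ : ℝ → ℝ} {w : ℝ → ℂ}

theorem IsFoldedFourierKernel.kernelTransform_eq (hk : IsFoldedFourierKernel k A ξ w)
    (hw : Measurable w) (hw1 : ∀ τ, ‖w τ‖ = 1) {φ : ℝ → ℂ} (hφ : Integrable φ halfLineMeasure)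
    {t : ℝ} (ht : 0 < t) :
    kernelTransform k φ t = A t * 𝓕 (fun τ ↦ w τ * φ |τ|) (ξ t / (2 * π)) := by
  have hint : Integrable fun τ ↦ w τ * φ |τ| :=
    memLp_one_iff_integrable.1 (memLp_mul_comp_abs hw hw1 (memLp_one_iff_integrable.2 hφ))
  rw [fourier_div_two_pi, integral_eq_integral_Ioi_add (integrable_exp_neg_I_mul hint _),
    kernelTransform, ← integral_const_mul]
  refine setIntegral_congr_fun measurableSet_Ioi fun τ hτ ↦ ?_
  simp only [hk t τ ht hτ, abs_neg, abs_of_pos (mem_Ioi.1 hτ),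
    Complex.ofReal_neg, mul_neg, neg_mul, neg_neg]
  ring

theorem IsFoldedFourierKernel.aestronglyMeasurable (hk : IsFoldedFourierKernel k A ξ w)
    (hw : Measurable w) {t : ℝ} (ht : 0 < t) :
    AEStronglyMeasurable (k t) halfLineMeasure := by
  have : Measurable fun τ : ℝ ↦ (A t : ℂ) * (Complex.exp (-(Complex.I * τ * ξ t)) * w τ
    + Complex.exp (Complex.I * τ * ξ t) * w (-τ)) := by fun_prop
  refine this.aestronglyMeasurable.congr ?_
  filter_upwards [ae_restrict_mem measurableSet_Ioi] with τ hτ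
  exact (hk t τ ht hτ).symm

theorem IsFoldedFourierKernel.norm_le (hk : IsFoldedFourierKernel k A ξ w) (hw1 : ∀ τ, ‖w τ‖ = 1)
    {t τ : ℝ} (ht : 0 < t) (hτ : 0 < τ) :
    ‖k t τ‖ ≤ |A t| * 2 := by
  rw [hk t τ ht hτ, norm_mul, Complex.norm_real, Real.norm_eq_abs]
  gcongr
  refine (norm_add_le _ _).trans ?_
  have := norm_exp_neg_I_mul (-τ) (ξ t)
  rw [Complex.ofReal_neg, mul_neg, neg_mul, neg_neg] at this
  rw [norm_mul, norm_mul, hw1, hw1, this, norm_exp_neg_I_mul]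
  norm_num

/-- A folded Fourier kernel with unimodular weight defines an isometric operator as soon as the
change of variables `t ↦ ξ(t) / 2π` with density `A(t)²` turns the `L²` norm on `ℝ₊` into half the
`L²` norm on `ℝ`, for the Fourier transforms that occur. -/
theorem IsFoldedFourierKernel.existsUnique (hk : IsFoldedFourierKernel k A ξ w)
    (hw : Measurable w) (hw1 : ∀ τ, ‖w τ‖ = 1) (hA : Measurable A) (hξ : Measurable ξ)
    (hchange : ∀ φ : ℝ → ℂ, Integrable φ halfLineMeasure →
      2 * ∫⁻ t in Ioi 0, ‖(A t : ℂ) * 𝓕 (fun τ ↦ w τ * φ |τ|) (ξ t / (2 * π))‖ₑ ^ (2 : ℝ) =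
        ∫⁻ x, ‖𝓕 (fun τ ↦ w τ * φ |τ|) x‖ₑ ^ (2 : ℝ)) :
    ∃! B, IsIsometricExtension k B := by
  refine existsUnique_isIsometricExtension (fun t ht ↦ hk.aestronglyMeasurable hw ht)
    (fun t ht ↦ ⟨_, fun τ hτ ↦ hk.norm_le hw1 ht hτ⟩) fun φ hφ hφ2 ↦ ?_
  have h1 := memLp_one_iff_integrable.1
    (memLp_mul_comp_abs hw hw1 (memLp_one_iff_integrable.2 hφ))
  have h2 := memLp_mul_comp_abs hw hw1 hφ2
  have hcont : Continuous (𝓕 fun τ ↦ w τ * φ |τ|) :=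
    VectorFourier.fourierIntegral_continuous Real.continuous_fourierChar continuous_inner h1
  have heq : kernelTransform k φ =ᵐ[halfLineMeasure]
      fun t ↦ (A t : ℂ) * 𝓕 (fun τ ↦ w τ * φ |τ|) (ξ t / (2 * π)) := by
    filter_upwards [ae_restrict_mem measurableSet_Ioi] with t ht
    exact hk.kernelTransform_eq hw hw1 hφ ht
  have hnorm : eLpNorm (kernelTransform k φ) 2 halfLineMeasure = eLpNorm φ 2 halfLineMeasure := by
    rw [eLpNorm_congr_ae heq, eLpNorm_two_eq_iff]
    refine (ENNReal.mul_right_inj two_ne_zero ENNReal.ofNat_ne_top).1 ?_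
    rw [hchange φ hφ, lintegral_fourier h1 h2, lintegral_mul_comp_abs hw1]
  refine ⟨⟨?_, hnorm ▸ hφ2.2⟩, hnorm⟩
  refine AEStronglyMeasurable.congr ?_ heq.symm
  exact (by fun_prop : Measurable _).aestronglyMeasurable

end folded

theorem enorm_ofReal_mul_rpow_two (a : ℝ) (z : ℂ) :
    ‖(a : ℂ) * z‖ₑ ^ (2 : ℝ) = ENNReal.ofReal (a ^ 2) * ‖z‖ₑ ^ (2 : ℝ) := by
  rw [enorm_mul, ENNReal.mul_rpow_of_nonneg _ _ zero_le_two, ← ofReal_norm, Complex.norm_real,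
    ENNReal.ofReal_rpow_of_nonneg (norm_nonneg _) zero_le_two]
  norm_num

/-! ### The cosine and sine transforms -/

theorem enorm_fourier_neg {h : ℝ → ℂ} {ε : ℂ} (hε : ‖ε‖ = 1)
    (hh : ∀ᵐ x, h (-x) = ε * h x) (x : ℝ) :
    ‖𝓕 h (-x)‖ₑ = ‖𝓕 h x‖ₑ := by
  have : 𝓕 h (-x) = ε * 𝓕 h x := by
    rw [Real.fourier_real_eq_integral_exp_smul, Real.fourier_real_eq_integral_exp_smul,
      ← integral_neg_eq_self, ← integral_const_mul]
    refine integral_congr_ae ?_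
    filter_upwards [hh] with τ hτ
    simp only [hτ, smul_eq_mul, mul_neg, neg_mul, neg_neg]
    ring
  rw [this, enorm_mul, ← ofReal_norm ε, hε, ENNReal.ofReal_one, one_mul]

/-- The case of the cosine and sine kernels: the norm on the half-line is half of that on the line
because the Fourier transforms that occur are even or odd. -/
theorem existsUnique_of_fold_id {k : ℝ → ℝ → ℂ} {w : ℝ → ℂ} {ε : ℂ}
    (hk : IsFoldedFourierKernel k (fun _ ↦ √(1 / (2 * π))) id w) (hw : Measurable w)
    (hw1 : ∀ τ, ‖w τ‖ = 1) (hε : ‖ε‖ = 1) (hwε : ∀ τ, τ ≠ 0 → w (-τ) = ε * w τ) :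
    ∃! B, IsIsometricExtension k B := by
  refine hk.existsUnique hw hw1 measurable_const measurable_id fun φ hφ ↦ ?_
  set h := fun τ ↦ w τ * φ |τ| with hh
  have hev (x : ℝ) : ‖𝓕 h (-x)‖ₑ = ‖𝓕 h x‖ₑ := by
    refine enorm_fourier_neg hε ?_ x
    filter_upwards [Measure.ae_ne volume 0] with τ hτ
    simp [hh, hwε τ hτ, mul_assoc]
  have himg : (fun t : ℝ ↦ t / (2 * π)) '' Ioi 0 = Ioi 0 := by
    ext y
    simp only [mem_image, mem_Ioi]
    exact ⟨fun ⟨t, ht, e⟩ ↦ e ▸ by positivity,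
      fun hy ↦ ⟨y * (2 * π), by positivity, by field_simp⟩⟩
  have hcv := lintegral_image_eq_lintegral_abs_deriv_mul (f := fun t : ℝ ↦ t / (2 * π))
    (f' := fun _ ↦ 1 / (2 * π)) measurableSet_Ioi
    (fun t _ ↦ ((hasDerivAt_id t).div_const (2 * π)).hasDerivWithinAt)
    (fun a _ b _ e ↦ by
      have : a / (2 * π) = b / (2 * π) := e
      field_simp at this
      exact this) (fun x ↦ ‖𝓕 h x‖ₑ ^ (2 : ℝ)) (s := Ioi 0)
  rw [himg] at hcv
  rw [lintegral_eq_lintegral_Ioi_add (fun x ↦ ‖𝓕 h x‖ₑ ^ (2 : ℝ))]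
  simp only [hev, ← two_mul, hcv, enorm_ofReal_mul_rpow_two, id]
  congr 3
  ext t
  rw [Real.sq_sqrt (by positivity), abs_of_pos (by positivity)]

/-- The sign of a real number, with value `-1` at `0` so as to be unimodular everywhere. -/
def unitSign (τ : ℝ) : ℂ := if 0 < τ then 1 else -1

theorem measurable_unitSign : Measurable unitSign :=
  Measurable.ite measurableSet_Ioi measurable_const measurable_const

theorem norm_unitSign (τ : ℝ) : ‖unitSign τ‖ = 1 := by
  unfold unitSign; split_ifs <;> simp

theorem unitSign_of_pos {τ : ℝ} (hτ : 0 < τ) : unitSign τ = 1 := if_pos hτ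

theorem unitSign_neg_of_pos {τ : ℝ} (hτ : 0 < τ) : unitSign (-τ) = -1 := if_neg (by linarith)

theorem sqrt_two_div_pi : √(2 / π) = √(1 / (2 * π)) * 2 := by
  rw [show (2 : ℝ) / π = 1 / (2 * π) * 2 ^ 2 by field_simp,
    Real.sqrt_mul (by positivity), Real.sqrt_sq zero_le_two]

theorem existsUnique_cosine : ∃! B, IsIsometricExtension cosineKernel B := by
  refine existsUnique_of_fold_id (w := fun _ ↦ 1) (ε := 1) (fun t τ _ _ ↦ ?_) measurable_const
    (by simp) (by simp) (by simp)
  rw [cosineKernel, sqrt_two_div_pi]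
  push_cast
  rw [Complex.cos]
  simp only [id]
  ring_nf

theorem existsUnique_sine : ∃! B, IsIsometricExtension sineKernel B := by
  refine existsUnique_of_fold_id (w := fun τ ↦ Complex.I * unitSign τ) (ε := -1)
    (fun t τ _ hτ ↦ ?_) (measurable_unitSign.const_mul _)
    (by simp [norm_unitSign]) (by simp) (fun τ hτ ↦ ?_)
  · simp only [id]
    rw [sineKernel, sqrt_two_div_pi, unitSign_of_pos hτ, unitSign_neg_of_pos hτ]
    push_cast
    rw [Complex.sin]
    ring_nf
  · rcases lt_or_gt_of_ne hτ with h | h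
    · have := unitSign_neg_of_pos (neg_pos.2 h)
      rw [neg_neg] at this
      rw [this, unitSign_of_pos (neg_pos.2 h)]; ring
    · rw [unitSign_of_pos h, unitSign_neg_of_pos h]; ring

/-! ### The transforms `T^±` -/

/-- The factor `t^{-1/2} / (2√π)` of the kernels `e^±`, written through `log t`. -/
def mellinAmplitude (t : ℝ) : ℝ := Real.exp (-(Real.log t / 2)) / (2 * √π)

theorem measurable_mellinAmplitude : Measurable mellinAmplitude := by
  unfold mellinAmplitude; fun_prop

/-- The case of the kernels `e^±`: the substitution `x = log t / 2π` maps `ℝ₊` onto `ℝ`. -/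
theorem existsUnique_of_fold_log {k : ℝ → ℝ → ℂ} {w : ℝ → ℂ}
    (hk : IsFoldedFourierKernel k mellinAmplitude Real.log w)
    (hw : Measurable w) (hw1 : ∀ τ, ‖w τ‖ = 1) :
    ∃! B, IsIsometricExtension k B := by
  refine hk.existsUnique hw hw1 measurable_mellinAmplitude Real.measurable_log fun φ hφ ↦ ?_
  set h := fun τ ↦ w τ * φ |τ| with hh
  have himg : (fun t : ℝ ↦ Real.log t / (2 * π)) '' Ioi 0 = univ := by
    refine eq_univ_of_forall fun y ↦ ⟨Real.exp (y * (2 * π)), Real.exp_pos _, ?_⟩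
    simp only [Real.log_exp]
    field_simp
  have hcv := lintegral_image_eq_lintegral_abs_deriv_mul (f := fun t : ℝ ↦ Real.log t / (2 * π))
    (f' := fun t ↦ t⁻¹ / (2 * π)) measurableSet_Ioi
    (fun t (ht : 0 < t) ↦ ((Real.hasDerivAt_log ht.ne').div_const (2 * π)).hasDerivWithinAt)
    (fun a ha b hb e ↦ by
      have : Real.log a / (2 * π) = Real.log b / (2 * π) := e
      field_simp at this
      exact Real.log_injOn_pos ha hb this) (fun x ↦ ‖𝓕 h x‖ₑ ^ (2 : ℝ)) (s := Ioi 0)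
  rw [himg, setLIntegral_univ] at hcv
  rw [hcv, ← lintegral_const_mul' _ _ ENNReal.ofNat_ne_top]
  refine setLIntegral_congr_fun measurableSet_Ioi fun t (ht : 0 < t) ↦ ?_
  simp only [enorm_ofReal_mul_rpow_two, mellinAmplitude]
  rw [← mul_assoc]
  congr 1
  rw [show (2 : ℝ≥0∞) = ENNReal.ofReal 2 by simp, ← ENNReal.ofReal_mul zero_le_two,
    abs_of_pos (by positivity), div_pow, ← Real.exp_nat_mul, mul_pow, Real.sq_sqrt Real.pi_pos.le,
    show ((2 : ℕ) : ℝ) * -(Real.log t / 2) = -Real.log t by push_cast; ring, Real.exp_neg,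
    Real.exp_log ht]
  congr 1
  field_simp

/-- The phase of `2^{iτ/2} Γ(ν + iτ/2)`. The phase factors `c` and `s` are the cases `ν = 1/4` and
`ν = 3/4`. -/
def mellinPhase (ν τ : ℝ) : ℂ :=
  (2 : ℂ) ^ (Complex.I * (τ / 2)) * gammaPhase (ν + Complex.I * (τ / 2))

theorem phaseC_eq : phaseC = mellinPhase (1 / 4) := by
  ext τ; simp [phaseC, mellinPhase]

theorem phaseS_eq : phaseS = mellinPhase (3 / 4) := by
  ext τ; simp [phaseS, mellinPhase]

section

variable {ν : ℝ}

theorem Gamma_line_ne_zero (hν : 0 < ν) (τ : ℝ) :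
    Complex.Gamma (ν + Complex.I * (τ / 2)) ≠ 0 :=
  Complex.Gamma_ne_zero_of_re_pos (by simpa using hν)

theorem continuous_Gamma_line (hν : 0 < ν) :
    Continuous fun τ : ℝ ↦ Complex.Gamma (ν + Complex.I * (τ / 2)) := by
  refine continuous_iff_continuousAt.2 fun τ ↦ ?_
  refine ContinuousAt.comp (f := fun τ : ℝ ↦ (ν + Complex.I * (τ / 2) : ℂ)) (g := Complex.Gamma)
    (Complex.differentiableAt_Gamma _ fun m hm ↦ ?_).continuousAt (by fun_prop)
  have := congrArg Complex.re hm
  simp at this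
  linarith [m.cast_nonneg (α := ℝ)]

theorem measurable_mellinPhase (hν : 0 < ν) : Measurable (mellinPhase ν) := by
  have h1 := (continuous_Gamma_line hν).measurable
  have h2 : Continuous fun τ : ℝ ↦ (2 : ℂ) ^ (Complex.I * (τ / 2)) := by
    refine continuous_const.cpow (by fun_prop) fun _ ↦ ?_
    left; norm_num
  exact h2.measurable.mul (h1.div (Complex.measurable_ofReal.comp h1.norm))

theorem norm_mellinPhase (hν : 0 < ν) (τ : ℝ) : ‖mellinPhase ν τ‖ = 1 := by
  have := norm_ne_zero_iff.2 (Gamma_line_ne_zero hν τ)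
  have h2 : ‖(2 : ℂ) ^ (Complex.I * (τ / 2))‖ = 1 := by
    rw [show (2 : ℂ) = ((2 : ℝ) : ℂ) by norm_num, Complex.norm_cpow_eq_rpow_re_of_pos two_pos]
    simp
  rw [mellinPhase, gammaPhase, norm_mul, h2, norm_div, Complex.norm_real, norm_norm, div_self this,
    one_mul]

theorem cpow_neg_half_sub {t : ℝ} (ht : 0 < t) (τ : ℝ) :
    (t : ℂ) ^ (-(1 / 2) - Complex.I * τ : ℂ) =
      Real.exp (-(Real.log t / 2)) * Complex.exp (-(Complex.I * τ * Real.log t)) := by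
  rw [Complex.cpow_def_of_ne_zero (by exact_mod_cast ht.ne'), ← Complex.ofReal_log ht.le,
    Complex.ofReal_exp, ← Complex.exp_add]
  congr 1
  push_cast
  ring

theorem isFoldedFourierKernel_log {k : ℝ → ℝ → ℂ} {w : ℝ → ℂ}
    (hk : ∀ t τ : ℝ, 0 < t → 0 < τ → k t τ = 1 / (2 * (√π : ℂ)) *
      ((t : ℂ) ^ (-(1 / 2) - Complex.I * τ : ℂ) * w τ
        + (t : ℂ) ^ (-(1 / 2) + Complex.I * τ : ℂ) * w (-τ))) :
    IsFoldedFourierKernel k mellinAmplitude Real.log w := by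
  intro t τ ht hτ
  have h := cpow_neg_half_sub ht (-τ)
  rw [Complex.ofReal_neg, mul_neg, sub_neg_eq_add, neg_mul, neg_neg] at h
  rw [hk t τ ht hτ, h, cpow_neg_half_sub ht, mellinAmplitude]
  push_cast
  ring

/-- The weight of the kernels `e^-`: the phase factor times `1 / i` and the sign of `τ`. -/
def signedMellinPhase (ν τ : ℝ) : ℂ := -Complex.I * unitSign τ * mellinPhase ν τ

theorem measurable_signedMellinPhase (hν : 0 < ν) : Measurable (signedMellinPhase ν) :=
  (measurable_unitSign.const_mul _).mul (measurable_mellinPhase hν)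

theorem norm_signedMellinPhase (hν : 0 < ν) (τ : ℝ) : ‖signedMellinPhase ν τ‖ = 1 := by
  simp [signedMellinPhase, norm_mellinPhase hν, norm_unitSign]

/-- The minus sign in `e^-` is absorbed into the odd weight `unitSign`. -/
theorem isFoldedFourierKernel_minus {k : ℝ → ℝ → ℂ}
    (hk : ∀ t τ : ℝ, k t τ = 1 / (2 * Complex.I * (√π : ℂ)) *
      ((t : ℂ) ^ (-(1 / 2) - Complex.I * τ : ℂ) * mellinPhase ν τ
        - (t : ℂ) ^ (-(1 / 2) + Complex.I * τ : ℂ) * mellinPhase ν (-τ))) :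
    IsFoldedFourierKernel k mellinAmplitude Real.log (signedMellinPhase ν) := by
  refine isFoldedFourierKernel_log fun t τ _ hτ ↦ ?_
  rw [hk, signedMellinPhase, signedMellinPhase, unitSign_of_pos hτ,
    unitSign_neg_of_pos hτ, mul_assoc 2, mul_left_comm 2, ← div_div, one_div, Complex.inv_I]
  ring

end

/-! ### The Gamma function on a vertical line and the Mellin transform of the Gaussian -/

/-- The modulus of `Γ` on the vertical line through `ν`, in the scaling of the phase factors. -/
def gammaModulus (ν τ : ℝ) : ℝ := ‖Complex.Gamma (ν + Complex.I * (τ / 2))‖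

section

variable {ν : ℝ}

theorem gammaModulus_pos (hν : 0 < ν) (τ : ℝ) : 0 < gammaModulus ν τ :=
  norm_pos_iff.2 (Gamma_line_ne_zero hν τ)

theorem gammaModulus_neg (ν τ : ℝ) : gammaModulus ν (-τ) = gammaModulus ν τ := by
  rw [gammaModulus, gammaModulus, ← Complex.norm_conj, ← Complex.Gamma_conj]
  simp [neg_div, Complex.conj_ofNat]

theorem gammaModulus_abs (ν τ : ℝ) : gammaModulus ν |τ| = gammaModulus ν τ := by
  rcases abs_choice τ with h | h <;> rw [h]
  exact gammaModulus_neg ν τ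

theorem continuous_gammaModulus (hν : 0 < ν) : Continuous (gammaModulus ν) :=
  (continuous_Gamma_line hν).norm

theorem norm_Gamma_le {s : ℂ} (hs : 0 < s.re) : ‖Complex.Gamma s‖ ≤ Real.Gamma s.re := by
  rw [Complex.Gamma_eq_integral hs, Real.Gamma_eq_integral hs, Complex.GammaIntegral]
  refine (norm_integral_le_integral_norm _).trans_eq ?_
  refine setIntegral_congr_fun measurableSet_Ioi fun x hx ↦ ?_
  simp only [norm_mul, Complex.norm_real, Real.norm_eq_abs, Real.abs_exp,
    Complex.norm_cpow_eq_rpow_re_of_pos hx]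
  simp

theorem gammaModulus_le (hν : 0 < ν) (τ : ℝ) : gammaModulus ν τ ≤ Real.Gamma ν := by
  have := norm_Gamma_le (s := ν + Complex.I * (τ / 2)) (by simpa using hν)
  simpa [gammaModulus] using this

/-- Quadratic decay on vertical lines, from `Γ(s + 2) = s (s + 1) Γ(s)`. -/
theorem gammaModulus_mul_le (hν : 0 < ν) (τ : ℝ) :
    (τ ^ 2 / 4) * gammaModulus ν τ ≤ Real.Gamma (ν + 2) := by
  set s : ℂ := ν + Complex.I * (τ / 2) with hs
  have hre : s.re = ν := by simp [hs]
  have him : s.im = τ / 2 := by simp [hs]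
  have h0 : s ≠ 0 := fun h ↦ by rw [h, Complex.zero_re] at hre; linarith
  have h1 : s + 1 ≠ 0 := fun h ↦ by
    have := congrArg Complex.re h
    rw [Complex.add_re, hre, Complex.one_re, Complex.zero_re] at this
    linarith
  have h2 := norm_Gamma_le (s := s + 1 + 1) (by simp [hre]; linarith)
  rw [Complex.Gamma_add_one _ h1, Complex.Gamma_add_one _ h0, norm_mul, norm_mul] at h2
  have e : (s + 1 + 1).re = ν + 2 := by simp [hre]; ring
  rw [e] at h2
  refine le_trans ?_ h2
  rw [← mul_assoc]
  refine mul_le_mul_of_nonneg_right ?_ (norm_nonneg _)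
  have a1 := Complex.abs_im_le_norm s
  have a2 := Complex.abs_im_le_norm (s + 1)
  rw [him] at a1
  rw [Complex.add_im, him, Complex.one_im, add_zero] at a2
  calc τ ^ 2 / 4 = |τ / 2| * |τ / 2| := by rw [abs_mul_abs_self]; ring
    _ ≤ ‖s + 1‖ * ‖s‖ := mul_le_mul a2 a1 (abs_nonneg _) (norm_nonneg _)

theorem integrable_gammaModulus (hν : 0 < ν) : Integrable (gammaModulus ν) := by
  refine (integrable_inv_one_add_sq.const_mul (Real.Gamma ν + 4 * Real.Gamma (ν + 2))).mono'
    (continuous_gammaModulus hν).aestronglyMeasurable (Eventually.of_forall fun τ ↦ ?_)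
  rw [Real.norm_of_nonneg (gammaModulus_pos hν τ).le, ← div_eq_mul_inv, le_div_iff₀ (by positivity)]
  linarith [gammaModulus_le hν τ, gammaModulus_mul_le hν τ]

theorem memLp_two_gammaModulus (hν : 0 < ν) : MemLp (gammaModulus ν) 2 := by
  rw [memLp_two_iff_integrable_sq (continuous_gammaModulus hν).aestronglyMeasurable]
  simp only [sq]
  refine (integrable_gammaModulus hν).bdd_mul (c := Real.Gamma ν)
    (continuous_gammaModulus hν).aestronglyMeasurable (Eventually.of_forall fun τ ↦ ?_)
  rw [Real.norm_of_nonneg (gammaModulus_pos hν τ).le]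
  exact gammaModulus_le hν τ

theorem mellinPhase_mul_gammaModulus (hν : 0 < ν) (τ : ℝ) :
    mellinPhase ν τ * gammaModulus ν τ =
      (2 : ℂ) ^ (Complex.I * (τ / 2)) * Complex.Gamma (ν + Complex.I * (τ / 2)) := by
  have := (gammaModulus_pos hν τ).ne'
  rw [mellinPhase, gammaPhase, gammaModulus, mul_assoc, div_mul_cancel₀]
  rw [gammaModulus] at this
  exact Complex.ofReal_ne_zero.2 this

theorem mellin_gaussian {s : ℂ} (hs : 0 < s.re) :
    mellin (fun t : ℝ ↦ Complex.exp (-(t ^ 2 / 2))) s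
      = 1 / 2 * ((2 : ℂ) ^ (s / 2) * Complex.Gamma (s / 2)) := by
  have h := mellin_comp_rpow (fun u : ℝ ↦ Complex.exp (-((1 / 2 : ℝ) * u))) s 2
  have h2 := Complex.integral_cpow_mul_exp_neg_mul_Ioi (a := s / 2) (r := 1 / 2)
    (by simpa using hs) (by norm_num)
  have h3 : mellin (fun t : ℝ ↦ Complex.exp (-(t ^ 2 / 2))) s
      = mellin (fun t : ℝ ↦ Complex.exp (-((1 / 2 : ℝ) * (t ^ (2 : ℝ) : ℝ)))) s := by
    congr 1
    ext t
    congr 1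
    rw [Real.rpow_two]; push_cast; ring
  rw [h3, h, mellin]
  simp only [smul_eq_mul]
  rw [show (s / ((2 : ℝ) : ℂ)) = s / 2 by norm_num, h2]
  simp

theorem mellinConvergent_gaussian {σ : ℝ} (hσ : 0 < σ) :
    MellinConvergent (fun t : ℝ ↦ Complex.exp (-(t ^ 2 / 2))) σ := by
  have h := (integrableOn_rpow_mul_exp_neg_mul_sq (b := 1 / 2) (by norm_num)
    (show -1 < σ - 1 by linarith)).ofReal (𝕜 := ℂ)
  refine h.congr ?_
  filter_upwards [ae_restrict_mem measurableSet_Ioi] with t ht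
  simp only [Complex.coe_algebraMap]
  rw [Complex.ofReal_mul, Complex.ofReal_cpow (le_of_lt ht)]
  push_cast
  rw [smul_eq_mul]
  congr 2
  ring

/-- Mellin inversion for the Gaussian: the density `2^{iτ/2} Γ(ν + iτ/2)`, whose phase is
`mellinPhase ν`, is up to a factor the Mellin transform of `e^{-x²/2}` on the line `Re s = 2ν`. -/
theorem integral_exp_mul_mellinPhase (hν : 0 < ν) (y : ℝ) :
    ∫ τ : ℝ, Complex.exp (-(Complex.I * τ * y)) * (mellinPhase ν τ * gammaModulus ν τ) =
      (4 * π * 2 ^ (-ν) * Real.exp (2 * ν * y - Real.exp (2 * y) / 2) : ℝ) := by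
  set f : ℝ → ℂ := fun t ↦ Complex.exp (-(t ^ 2 / 2)) with hf
  have hm (τ : ℝ) : mellin f (((2 * ν : ℝ) : ℂ) + τ * Complex.I) =
      ((1 / 2 * 2 ^ ν : ℝ) : ℂ) * (mellinPhase ν τ * gammaModulus ν τ) := by
    rw [hf, mellin_gaussian (by simpa using hν), mellinPhase_mul_gammaModulus hν,
      show (((2 * ν : ℝ) : ℂ) + τ * Complex.I) / 2 = ν + Complex.I * (τ / 2) by push_cast; ring,
      Complex.cpow_add _ _ two_ne_zero]
    rw [Complex.ofReal_mul, Complex.ofReal_cpow zero_le_two]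
    push_cast
    ring
  have hv : Complex.VerticalIntegrable (mellin f) (2 * ν) := by
    rw [Complex.VerticalIntegrable]
    simp only [hm]
    refine Integrable.const_mul ?_ _
    refine (integrable_gammaModulus hν).ofReal.bdd_mul (c := 1)
      (measurable_mellinPhase hν).aestronglyMeasurable
      (Eventually.of_forall fun τ ↦ (norm_mellinPhase hν τ).le)
  have hinv := mellinInv_mellin_eq (2 * ν) f (Real.exp_pos y)
    (mellinConvergent_gaussian (by linarith)) hv (by fun_prop)
  have hx (τ : ℝ) : ((Real.exp y : ℝ) : ℂ) ^ (-(((2 * ν : ℝ) : ℂ) + τ * Complex.I)) =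
      (Real.exp (-(2 * ν * y)) : ℝ) * Complex.exp (-(Complex.I * τ * y)) := by
    rw [Complex.cpow_def_of_ne_zero (by exact_mod_cast (Real.exp_pos y).ne'),
      ← Complex.ofReal_log (Real.exp_pos y).le, Real.log_exp, Complex.ofReal_exp, ← Complex.exp_add]
    congr 1
    push_cast
    ring_nf
  have hcomb (τ : ℝ) : (Real.exp (-(2 * ν * y)) : ℂ) * Complex.exp (-(Complex.I * τ * y)) *
      (((1 / 2 * 2 ^ ν : ℝ) : ℂ) * (mellinPhase ν τ * gammaModulus ν τ)) =
      ((Real.exp (-(2 * ν * y)) * (1 / 2 * 2 ^ ν) : ℝ) : ℂ) *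
        (Complex.exp (-(Complex.I * τ * y)) * (mellinPhase ν τ * gammaModulus ν τ)) := by
    push_cast; ring
  rw [mellinInv] at hinv
  simp only [hm, hx, smul_eq_mul, hcomb] at hinv
  rw [integral_const_mul] at hinv
  set J := ∫ τ : ℝ, Complex.exp (-(Complex.I * τ * y)) * (mellinPhase ν τ * gammaModulus ν τ)
  have hfe : f (Real.exp y) = (Real.exp (-(Real.exp (2 * y) / 2)) : ℝ) := by
    rw [hf, Complex.ofReal_exp]
    rw [show 2 * y = y + y by ring, Real.exp_add]
    push_cast
    ring_nf
  rw [hfe, Complex.real_smul, ← mul_assoc, ← Complex.ofReal_mul] at hinv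
  have hc : 1 / (2 * π) * (Real.exp (-(2 * ν * y)) * (1 / 2 * 2 ^ ν)) ≠ 0 := by positivity
  have hc' : ((1 / (2 * π) * (Real.exp (-(2 * ν * y)) * (1 / 2 * 2 ^ ν)) : ℝ) : ℂ) ≠ 0 := by
    exact_mod_cast hc
  rw [mul_comm, ← eq_div_iff hc', ← Complex.ofReal_div] at hinv
  rw [hinv, Real.rpow_neg zero_le_two, sub_eq_add_neg, Real.exp_add, Real.exp_neg (2 * ν * y)]
  congr 1
  field_simp
  norm_num

end

/-! ### The Gaussian profiles and their preimages -/

theorem IsIsometricExtension.apply_toLp {k : ℝ → ℝ → ℂ} {A : L2HalfLine →L[ℂ] L2HalfLine}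
    (hA : IsIsometricExtension k A) {φ : ℝ → ℂ} (h1 : Integrable φ halfLineMeasure)
    (h2 : MemLp φ 2 halfLineMeasure) :
    A (h2.toLp φ) =ᵐ[halfLineMeasure] kernelTransform k φ := by
  have := hA.2 (h2.toLp φ) (h1.congr h2.coeFn_toLp.symm)
  rwa [kernelTransform_congr h2.coeFn_toLp] at this

/-- The function `t ↦ e^{2νb} t^{2ν - 1/2} exp(-e^{2b} t² / 2)` on `ℝ₊`, written in the variable
`log t + b`, in which the unitary dilation by `e^b` becomes a translation. -/
def gaussianProfile (ν b t : ℝ) : ℝ :=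
  Real.exp (-(Real.log t / 2)) *
    Real.exp (2 * ν * (Real.log t + b) - Real.exp (2 * (Real.log t + b)) / 2)

theorem gaussianProfile_eq (ν b : ℝ) {t : ℝ} (ht : 0 < t) :
    gaussianProfile ν b t =
      Real.exp (2 * ν * b) *
        (t ^ (2 * ν - 1 / 2) * Real.exp (-(Real.exp (2 * b) / 2) * t ^ 2)) := by
  have h : Real.exp (2 * (Real.log t + b)) = Real.exp (2 * b) * t ^ 2 := by
    rw [mul_add, Real.exp_add, mul_comm 2 (Real.log t), Real.exp_mul, Real.exp_log ht,
      Real.rpow_two, mul_comm]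
  rw [gaussianProfile, h, Real.rpow_def_of_pos ht, ← Real.exp_add, ← Real.exp_add, ← Real.exp_add]
  congr 1
  ring

section

variable {ν : ℝ}

theorem integrable_gaussianProfile (hν : 0 < ν) (b : ℝ) :
    Integrable (gaussianProfile ν b) halfLineMeasure := by
  have h := (integrableOn_rpow_mul_exp_neg_mul_sq (b := Real.exp (2 * b) / 2) (by positivity)
    (show -1 < 2 * ν - 1 / 2 by linarith)).const_mul (Real.exp (2 * ν * b))
  refine h.congr ?_
  filter_upwards [ae_restrict_mem measurableSet_Ioi] with t ht
  rw [gaussianProfile_eq ν b ht]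

theorem memLp_gaussianProfile (hν : 0 < ν) (b : ℝ) :
    MemLp (fun t ↦ (gaussianProfile ν b t : ℂ)) 2 halfLineMeasure := by
  have : MemLp (gaussianProfile ν b) 2 halfLineMeasure := by
    rw [memLp_two_iff_integrable_sq (integrable_gaussianProfile hν b).1]
    have h := (integrableOn_rpow_mul_exp_neg_mul_sq (b := Real.exp (2 * b)) (by positivity)
      (show -1 < 4 * ν - 1 by linarith)).const_mul (Real.exp (2 * ν * b) ^ 2)
    refine h.congr ?_
    filter_upwards [ae_restrict_mem measurableSet_Ioi] with t (ht : 0 < t)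
    rw [gaussianProfile_eq ν b ht, mul_pow, mul_pow, ← Real.rpow_mul_natCast ht.le,
      ← Real.exp_nat_mul (-(Real.exp (2 * b) / 2) * t ^ 2) 2]
    push_cast
    ring_nf
  exact this.ofReal

/-- The Gaussian profile as an element of `L²(ℝ₊)`. -/
def profileLp (hν : 0 < ν) (b : ℝ) : L2HalfLine := (memLp_gaussianProfile hν b).toLp _

/-- Bounded measurable functions times `|Γ|` are in `L¹ ∩ L²`. -/
theorem integrable_gammaModulus_mul (hν : 0 < ν) {g : ℝ → ℂ} (hg : Measurable g) {C : ℝ}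
    (hC : ∀ τ, ‖g τ‖ ≤ C) : Integrable (fun τ ↦ (gammaModulus ν τ : ℂ) * g τ) :=
  (integrable_gammaModulus hν).ofReal.mul_bdd hg.aestronglyMeasurable (Eventually.of_forall hC)

theorem memLp_gammaModulus_mul (hν : 0 < ν) {g : ℝ → ℂ} (hg : Measurable g) {C : ℝ}
    (hC : ∀ τ, ‖g τ‖ ≤ C) :
    MemLp (fun τ ↦ (gammaModulus ν τ : ℂ) * g τ) 2 halfLineMeasure := by
  have h : MemLp (fun τ ↦ (gammaModulus ν τ : ℂ)) 2 halfLineMeasure :=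
    (memLp_two_gammaModulus hν).ofReal.restrict _
  refine MemLp.of_le_mul (c := C) h (h.1.mul hg.aestronglyMeasurable)
    (Eventually.of_forall fun τ ↦ ?_)
  rw [norm_mul, mul_comm]
  exact mul_le_mul_of_nonneg_right (hC τ) (norm_nonneg _)

theorem norm_cosineKernel_le (b τ : ℝ) : ‖cosineKernel b τ‖ ≤ √(2 / π) := by
  rw [cosineKernel, Complex.norm_real, norm_mul, Real.norm_of_nonneg (Real.sqrt_nonneg _)]
  exact mul_le_of_le_one_right (Real.sqrt_nonneg _) (Real.abs_cos_le_one _)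

theorem norm_sineKernel_le (b τ : ℝ) : ‖sineKernel b τ‖ ≤ √(2 / π) := by
  rw [sineKernel, Complex.norm_real, norm_mul, Real.norm_of_nonneg (Real.sqrt_nonneg _)]
  exact mul_le_of_le_one_right (Real.sqrt_nonneg _) (Real.abs_sin_le_one _)

theorem measurable_cosineKernel (b : ℝ) : Measurable (cosineKernel b) := by
  unfold cosineKernel; fun_prop

theorem measurable_sineKernel (b : ℝ) : Measurable (sineKernel b) := by
  unfold sineKernel; fun_prop

theorem integral_exp_mul_cosineKernel {F : ℝ → ℂ} (hF : Integrable F) (b y : ℝ) :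
    ∫ τ : ℝ, Complex.exp (-(Complex.I * τ * y)) * (F τ * cosineKernel b τ) =
      √(2 / π) / 2 * ((∫ τ : ℝ, Complex.exp (-(Complex.I * τ * (y + b : ℝ))) * F τ)
        + ∫ τ : ℝ, Complex.exp (-(Complex.I * τ * (y + -b : ℝ))) * F τ) := by
  rw [← integral_add (integrable_exp_neg_I_mul hF _) (integrable_exp_neg_I_mul hF _),
    ← integral_const_mul]
  congr 1
  ext τ
  rw [cosineKernel, Complex.ofReal_mul, Complex.ofReal_cos, Complex.cos]
  simp only [Complex.ofReal_add, mul_add, neg_add, Complex.exp_add, Complex.ofReal_neg]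
  rw [show -(Complex.I * τ * -(b : ℂ)) = ((b * τ : ℝ) : ℂ) * Complex.I by push_cast; ring,
    show -(Complex.I * τ * (b : ℂ)) = -((b * τ : ℝ) : ℂ) * Complex.I by push_cast; ring]
  ring

theorem integral_exp_mul_sineKernel {F : ℝ → ℂ} (hF : Integrable F) (b y : ℝ) :
    ∫ τ : ℝ, Complex.exp (-(Complex.I * τ * y)) * (F τ * sineKernel b τ) =
      √(2 / π) / 2 * Complex.I * ((∫ τ : ℝ, Complex.exp (-(Complex.I * τ * (y + b : ℝ))) * F τ)
        - ∫ τ : ℝ, Complex.exp (-(Complex.I * τ * (y + -b : ℝ))) * F τ) := by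
  rw [← integral_sub (integrable_exp_neg_I_mul hF _) (integrable_exp_neg_I_mul hF _),
    ← integral_const_mul]
  congr 1
  ext τ
  rw [sineKernel, Complex.ofReal_mul, Complex.ofReal_sin, Complex.sin]
  simp only [Complex.ofReal_add, mul_add, neg_add, Complex.exp_add, Complex.ofReal_neg]
  rw [show -(Complex.I * τ * -(b : ℂ)) = ((b * τ : ℝ) : ℂ) * Complex.I by push_cast; ring,
    show -(Complex.I * τ * (b : ℂ)) = -((b * τ : ℝ) : ℂ) * Complex.I by push_cast; ring]
  ring

/-- The constant relating `T^±` of the test functions to the Gaussian profiles. -/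
def profileConst (ν : ℝ) : ℝ := 1 / (2 * √π) * (√(2 / π) / 2 * (4 * π * 2 ^ (-ν)))

theorem profileConst_pos (ν : ℝ) : 0 < profileConst ν := by
  unfold profileConst; positivity

/-- The function `|Γ(ν + iτ/2)| cos(bτ)`, up to a constant, as an element of `L²(ℝ₊)`. -/
def cosineTest (hν : 0 < ν) (b : ℝ) : L2HalfLine :=
  (memLp_gammaModulus_mul hν (measurable_cosineKernel b) (norm_cosineKernel_le b)).toLp _

/-- The function `|Γ(ν + iτ/2)| sin(bτ)`, up to a constant, as an element of `L²(ℝ₊)`. -/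
def sineTest (hν : 0 < ν) (b : ℝ) : L2HalfLine :=
  (memLp_gammaModulus_mul hν (measurable_sineKernel b) (norm_sineKernel_le b)).toLp _

theorem integrable_mellinPhase_mul (hν : 0 < ν) :
    Integrable fun τ ↦ mellinPhase ν τ * gammaModulus ν τ :=
  (integrable_gammaModulus hν).ofReal.bdd_mul (c := 1)
      (measurable_mellinPhase hν).aestronglyMeasurable
      (Eventually.of_forall fun τ ↦ (norm_mellinPhase hν τ).le)

variable {k : ℝ → ℝ → ℂ} {T : L2HalfLine →L[ℂ] L2HalfLine}

/-- The Mellin inversion formula, with `cos(bτ)` split into exponentials that translate `log t`. -/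
theorem transformPlus_cosineTest (hν : 0 < ν)
    (hk : IsFoldedFourierKernel k mellinAmplitude Real.log (mellinPhase ν))
    (hT : IsIsometricExtension k T) (b : ℝ) :
    T (cosineTest hν b) = (profileConst ν : ℂ) • (profileLp hν b + profileLp hν (-b)) := by
  have hint := integrable_gammaModulus_mul hν (measurable_cosineKernel b) (norm_cosineKernel_le b)
  refine Lp.ext ((hT.apply_toLp hint.integrableOn _).trans ?_)
  filter_upwards [ae_restrict_mem measurableSet_Ioi, Lp.coeFn_smul (profileConst ν : ℂ)
    (profileLp hν b + profileLp hν (-b)), Lp.coeFn_add (profileLp hν b) (profileLp hν (-b)),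
    (memLp_gaussianProfile hν b).coeFn_toLp, (memLp_gaussianProfile hν (-b)).coeFn_toLp]
    with t ht h1 h2 h3 h4
  rw [h1, Pi.smul_apply, h2, Pi.add_apply, profileLp, profileLp, h3, h4,
    hk.kernelTransform_eq (measurable_mellinPhase hν) (norm_mellinPhase hν) hint.integrableOn ht,
    fourier_div_two_pi]
  have he (τ : ℝ) : mellinPhase ν τ * ((gammaModulus ν |τ| : ℂ) * cosineKernel b |τ|) =
      (mellinPhase ν τ * gammaModulus ν τ) * cosineKernel b τ := by
    rw [gammaModulus_abs, cosineKernel, cosineKernel, mul_assoc]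
    congr 4
    rcases abs_choice τ with h | h <;> simp [h]
  simp only [he]
  rw [integral_exp_mul_cosineKernel (integrable_mellinPhase_mul hν),
    integral_exp_mul_mellinPhase hν, integral_exp_mul_mellinPhase hν, gaussianProfile,
    gaussianProfile, profileConst, mellinAmplitude, smul_eq_mul]
  push_cast
  ring

theorem transformMinus_sineTest (hν : 0 < ν)
    (hk : IsFoldedFourierKernel k mellinAmplitude Real.log (signedMellinPhase ν))
    (hT : IsIsometricExtension k T) (b : ℝ) :
    T (sineTest hν b) = (profileConst ν : ℂ) • (profileLp hν b - profileLp hν (-b)) := by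
  have hint := integrable_gammaModulus_mul hν (measurable_sineKernel b) (norm_sineKernel_le b)
  refine Lp.ext ((hT.apply_toLp hint.integrableOn _).trans ?_)
  filter_upwards [ae_restrict_mem measurableSet_Ioi, Lp.coeFn_smul (profileConst ν : ℂ)
    (profileLp hν b - profileLp hν (-b)), Lp.coeFn_sub (profileLp hν b) (profileLp hν (-b)),
    (memLp_gaussianProfile hν b).coeFn_toLp, (memLp_gaussianProfile hν (-b)).coeFn_toLp]
    with t ht h1 h2 h3 h4
  rw [h1, Pi.smul_apply, h2, Pi.sub_apply, profileLp, profileLp, h3, h4,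
    hk.kernelTransform_eq (measurable_signedMellinPhase hν) (norm_signedMellinPhase hν)
      hint.integrableOn ht, fourier_div_two_pi]
  have he (τ : ℝ) : signedMellinPhase ν τ * ((gammaModulus ν |τ| : ℂ) * sineKernel b |τ|) =
      (-Complex.I * (mellinPhase ν τ * gammaModulus ν τ)) * sineKernel b τ := by
    -- at `τ = 0` both sides vanish, whatever the value of `unitSign`
    have : unitSign τ * sineKernel b |τ| = sineKernel b τ := by
      unfold unitSign
      split_ifs with h
      · rw [abs_of_pos h, one_mul]
      · rw [abs_of_nonpos (not_lt.1 h)]; simp [sineKernel]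
    rw [gammaModulus_abs, ← this, signedMellinPhase]
    ring
  simp only [he]
  rw [integral_exp_mul_sineKernel ((integrable_mellinPhase_mul hν).const_mul _)]
  simp only [mul_left_comm _ (-Complex.I), integral_const_mul]
  rw [integral_exp_mul_mellinPhase hν, integral_exp_mul_mellinPhase hν, gaussianProfile,
    gaussianProfile, profileConst, mellinAmplitude, smul_eq_mul]
  push_cast
  ring_nf
  rw [Complex.I_sq]
  ring

end

/-! ### Totality of the Gaussian profiles -/

/-- On `(0, ∞)` a compactly supported continuous function which vanishes at `0` is a continuous
function on `[0, 1]` of `e^{-t²/2}`. The value of the latter at `0` is that of `g` at `0`, since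
`Real.log 0 = 0`. -/
theorem exists_continuousOn_comp_gaussian {g : ℝ → ℝ} (hg : Continuous g)
    (hgs : HasCompactSupport g) (hg0 : g 0 = 0) :
    ∃ F : ℝ → ℝ, ContinuousOn F (Icc 0 1) ∧ ∀ t, 0 < t → F (Real.exp (-(t ^ 2 / 2))) = g t := by
  refine ⟨fun v ↦ g (√(-2 * Real.log v)), fun v hv ↦ ?_, fun t ht ↦ ?_⟩
  · rcases hv.1.eq_or_lt with rfl | hv0
    · obtain ⟨R, hR⟩ := hgs.isCompact.isBounded.subset_closedBall 0
      have hR' (t : ℝ) (ht : R < t) : g t = 0 := by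
        by_contra h
        have := hR (subset_tsupport g h)
        rw [Metric.mem_closedBall, Real.dist_0_eq_abs] at this
        linarith [le_abs_self t]
      have hev : (fun v ↦ g (√(-2 * Real.log v))) =ᶠ[𝓝[Icc 0 1] 0] fun _ ↦ 0 := by
        have hlt : ∀ᶠ v in 𝓝[Icc (0 : ℝ) 1] 0, v < Real.exp (-(R ^ 2 / 2)) :=
          mem_nhdsWithin_of_mem_nhds (Iio_mem_nhds (Real.exp_pos _))
        filter_upwards [hlt, self_mem_nhdsWithin] with v hv hvI
        rcases hvI.1.eq_or_lt with rfl | h0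
        · simp [hg0]
        · refine hR' _ (Real.lt_sqrt_of_sq_lt ?_)
          have := (Real.log_lt_iff_lt_exp h0).2 hv
          linarith
      exact ((continuousWithinAt_const (b := (0 : ℝ))).congr_of_eventuallyEq hev (by simp [hg0]))
    · have : ContinuousAt (fun v ↦ g (√(-2 * Real.log v))) v :=
        hg.continuousAt.comp (Real.continuous_sqrt.continuousAt.comp
          ((Real.continuousAt_log hv0.ne').const_mul (-2)))
      exact this.continuousWithinAt
  · simp only [Real.log_exp]
    rw [show -2 * -(t ^ 2 / 2) = t ^ 2 by ring, Real.sqrt_sq ht.le]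

/-- An integrable function on `(0, ∞)` all of whose moments with respect to `e^{-t²/2}` vanish is
zero, by Weierstrass approximation. -/
theorem ae_eq_zero_of_gaussian_moments {f : ℝ → ℂ} (hf : Integrable f halfLineMeasure)
    (h : ∀ n : ℕ, ∫ t in Ioi (0 : ℝ), (Real.exp (-(t ^ 2 / 2)) ^ n) • f t = 0) :
    f =ᵐ[halfLineMeasure] 0 := by
  have hu (t : ℝ) : Real.exp (-(t ^ 2 / 2)) ∈ Icc (0 : ℝ) 1 :=
    ⟨(Real.exp_pos _).le, Real.exp_le_one_iff.2 (by linarith [sq_nonneg t])⟩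
  have hpow (n : ℕ) (c : ℝ) :
      Integrable (fun t ↦ (c * Real.exp (-(t ^ 2 / 2)) ^ n) • f t) halfLineMeasure := by
    simp only [mul_smul]
    refine (hf.bdd_smul 1 (φ := fun t ↦ Real.exp (-(t ^ 2 / 2)) ^ n)
      (by fun_prop) (Eventually.of_forall fun t ↦ ?_)).smul c
    rw [Real.norm_of_nonneg (pow_nonneg (hu t).1 n)]
    exact pow_le_one₀ (hu t).1 (hu t).2
  have hpoly (p : Polynomial ℝ) :
      Integrable (fun t ↦ p.eval (Real.exp (-(t ^ 2 / 2))) • f t) halfLineMeasure ∧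
        ∫ t in Ioi (0 : ℝ), p.eval (Real.exp (-(t ^ 2 / 2))) • f t = 0 := by
    simp only [Polynomial.eval_eq_sum_range, Finset.sum_smul]
    refine ⟨integrable_finsetSum _ fun n _ ↦ hpow n _, ?_⟩
    rw [integral_finsetSum _ fun n _ ↦ hpow n _]
    refine Finset.sum_eq_zero fun n _ ↦ ?_
    simp only [mul_smul, integral_smul, h n, smul_zero]
  refine (ae_restrict_iff' measurableSet_Ioi).2 ?_
  refine isOpen_Ioi.ae_eq_zero_of_integral_contDiff_smul_eq_zero
    (IntegrableOn.locallyIntegrableOn hf) fun g hg hgs hgt ↦ ?_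
  have hg0 (t : ℝ) (ht : t ∉ Ioi 0) : g t = 0 :=
    image_eq_zero_of_notMem_tsupport fun h ↦ ht (hgt h)
  rw [← setIntegral_eq_integral_of_forall_compl_eq_zero (s := Ioi 0)
    (fun t ht ↦ by rw [hg0 t ht, zero_smul])]
  obtain ⟨F, hF, hFg⟩ := exists_continuousOn_comp_gaussian hg.continuous hgs (hg0 0 (by simp))
  have hgf : Integrable (fun t ↦ g t • f t) halfLineMeasure := by
    obtain ⟨C, hC⟩ := hgs.exists_bound_of_continuous hg.continuous
    exact hf.bdd_smul C hg.continuous.aestronglyMeasurable (Eventually.of_forall hC)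
  refine norm_le_zero_iff.1 (le_of_forall_pos_le_add fun ε hε ↦ ?_)
  set M := ∫ t in Ioi (0 : ℝ), ‖f t‖ with hM
  have hM0 : 0 ≤ M := integral_nonneg fun _ ↦ norm_nonneg _
  obtain ⟨p, hp⟩ := exists_polynomial_near_of_continuousOn 0 1 F hF (ε / (M + 1)) (by positivity)
  calc ‖∫ t in Ioi (0 : ℝ), g t • f t‖
      = ‖∫ t in Ioi (0 : ℝ), (p.eval (Real.exp (-(t ^ 2 / 2))) • f t - g t • f t)‖ := by
        rw [integral_sub (hpoly p).1 hgf, (hpoly p).2, zero_sub, norm_neg]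
    _ ≤ ∫ t in Ioi (0 : ℝ), ε / (M + 1) * ‖f t‖ := by
        refine norm_integral_le_of_norm_le (hf.norm.const_mul _) ?_
        filter_upwards [ae_restrict_mem measurableSet_Ioi] with t ht
        rw [← sub_smul, norm_smul, ← hFg t ht]
        exact mul_le_mul_of_nonneg_right (hp _ (hu t)).le (norm_nonneg _)
    _ = ε * (M / (M + 1)) := by rw [integral_const_mul]; ring
    _ ≤ 0 + ε := by
        rw [zero_add]
        exact mul_le_of_le_one_right hε.le ((div_le_one (by positivity)).2 (by linarith))

theorem inner_toLp_ofReal {g : ℝ → ℝ} (hg : MemLp (fun t ↦ (g t : ℂ)) 2 halfLineMeasure)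
    (x : L2HalfLine) : inner ℂ (hg.toLp _) x = ∫ t in Ioi (0 : ℝ), (g t : ℂ) * x t := by
  rw [L2.inner_def]
  refine integral_congr_ae ?_
  filter_upwards [hg.coeFn_toLp] with t ht
  rw [ht, RCLike.inner_apply, Complex.conj_ofReal, mul_comm]

theorem integrable_ofReal_mul_Lp {g : ℝ → ℝ} (hg : MemLp (fun t ↦ (g t : ℂ)) 2 halfLineMeasure)
    (x : L2HalfLine) : Integrable (fun t ↦ (g t : ℂ) * x t) halfLineMeasure :=
  hg.integrable_mul (Lp.memLp x)

theorem eq_zero_of_inner_profileLp {ν : ℝ} (hν : 0 < ν) {x : L2HalfLine}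
    (hx : ∀ b, inner ℂ (profileLp hν b) x = 0) : x = 0 := by
  have hf := integrable_ofReal_mul_Lp (memLp_gaussianProfile hν 0) x
  have hzero := ae_eq_zero_of_gaussian_moments hf fun n ↦ ?_
  · refine Lp.ext ?_
    filter_upwards [hzero, Lp.coeFn_zero ℂ 2 halfLineMeasure] with t ht h0
    have hpos : (gaussianProfile ν 0 t : ℂ) ≠ 0 := by
      rw [gaussianProfile]
      exact_mod_cast (by positivity)
    rw [h0]
    exact (mul_eq_zero.1 ht).resolve_left hpos
  · -- the scale `e^{2b} = n + 1` produces the `n`-th power of `e^{-t²/2}`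
    have hb := hx (Real.log (n + 1) / 2)
    rw [profileLp, inner_toLp_ofReal] at hb
    have he : Real.exp (2 * (Real.log (n + 1) / 2)) = n + 1 := by
      rw [mul_div_cancel₀ _ two_ne_zero, Real.exp_log (by positivity)]
    have hc : (Real.exp (2 * ν * (Real.log (n + 1) / 2)) : ℂ) ≠ 0 := by
      exact_mod_cast (Real.exp_pos _).ne'
    rw [← mul_eq_zero_iff_left hc, mul_comm, ← integral_mul_const, ← hb]
    refine setIntegral_congr_fun measurableSet_Ioi fun t (ht : 0 < t) ↦ ?_
    have hid : gaussianProfile ν (Real.log (n + 1) / 2) t = Real.exp (-(t ^ 2 / 2)) ^ n *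
        gaussianProfile ν 0 t * Real.exp (2 * ν * (Real.log (n + 1) / 2)) := by
      have hexp : Real.exp (-((n + 1 : ℝ) / 2) * t ^ 2) =
          Real.exp (-(t ^ 2 / 2)) ^ n * Real.exp (-(1 / 2) * t ^ 2) := by
        rw [← Real.exp_nat_mul, ← Real.exp_add]
        congr 1
        ring
      rw [gaussianProfile_eq ν _ ht, gaussianProfile_eq ν _ ht, he, hexp, mul_zero, mul_zero,
        Real.exp_zero]
      ring
    simp only [hid, Complex.real_smul, Complex.ofReal_mul]
    ring

/-! ### The cosine and sine transforms of the Gaussian profiles -/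

theorem integrable_exp_neg_mul_sq_Ioi {β : ℝ} (hβ : 0 < β) :
    IntegrableOn (fun ξ : ℝ ↦ Real.exp (-β * ξ ^ 2)) (Ioi 0) :=
  (integrable_exp_neg_mul_sq hβ).integrableOn

theorem integrable_cos_mul_gaussian {β : ℝ} (hβ : 0 < β) (t : ℝ) :
    IntegrableOn (fun ξ : ℝ ↦ Real.cos (t * ξ) * Real.exp (-β * ξ ^ 2)) (Ioi 0) :=
  (integrable_exp_neg_mul_sq_Ioi hβ).bdd_mul (c := 1) (by fun_prop)
    (Eventually.of_forall fun ξ ↦ Real.abs_cos_le_one _)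

theorem integral_cos_mul_gaussian {β : ℝ} (hβ : 0 < β) (t : ℝ) :
    ∫ ξ in Ioi (0 : ℝ), Real.cos (t * ξ) * Real.exp (-β * ξ ^ 2) =
      √(π / β) / 2 * Real.exp (-t ^ 2 / (4 * β)) := by
  have h := fourierIntegral_gaussian (b := (β : ℂ)) (by simpa using hβ) t
  have hint : Integrable fun x : ℝ ↦
      Complex.exp (Complex.I * t * x) * Complex.exp (-β * x ^ 2) := by
    refine (integrable_cexp_neg_mul_sq (b := (β : ℂ)) (by simpa using hβ)).bdd_mul (c := 1)
      (by fun_prop) (Eventually.of_forall fun x ↦ ?_)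
    rw [show Complex.I * t * x = ((t * x : ℝ) : ℂ) * Complex.I by push_cast; ring,
      Complex.norm_exp_ofReal_mul_I]
  rw [integral_eq_integral_Ioi_add hint] at h
  have hcos : ∫ ξ in Ioi (0 : ℝ), ((2 * (Real.cos (t * ξ) * Real.exp (-β * ξ ^ 2)) : ℝ) : ℂ) =
      ((√(π / β) * Real.exp (-t ^ 2 / (4 * β)) : ℝ) : ℂ) := by
    calc _ = _ := ?_
      _ = _ := h
      _ = _ := ?_
    · refine setIntegral_congr_fun measurableSet_Ioi fun ξ _ ↦ ?_
      push_cast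
      rw [Complex.cos, neg_sq]
      ring_nf
    · rw [Real.sqrt_eq_rpow, Complex.ofReal_mul, Complex.ofReal_cpow (by positivity)]
      push_cast
      rfl
  rw [integral_complex_ofReal, Complex.ofReal_inj, integral_const_mul] at hcos
  linarith

theorem integral_sin_mul_gaussian {β : ℝ} (hβ : 0 < β) (t : ℝ) :
    ∫ ξ in Ioi (0 : ℝ), Real.sin (t * ξ) * (ξ * Real.exp (-β * ξ ^ 2)) =
      t / (2 * β) * (√(π / β) / 2 * Real.exp (-t ^ 2 / (4 * β))) := by
  have hsin : IntegrableOn (fun ξ : ℝ ↦ Real.sin (t * ξ) * (ξ * Real.exp (-β * ξ ^ 2))) (Ioi 0) :=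
    ((integrable_mul_exp_neg_mul_sq hβ).integrableOn).bdd_mul (c := 1) (by fun_prop)
      (Eventually.of_forall fun ξ ↦ Real.abs_sin_le_one _)
  have hcos := (integrable_cos_mul_gaussian hβ t).const_mul (t / (2 * β))
  -- integration by parts, in the form of an explicit primitive vanishing at `0` and at infinity
  have hderiv (ξ : ℝ) : HasDerivAt
      (fun ξ ↦ -(1 / (2 * β)) * (Real.sin (t * ξ) * Real.exp (-β * ξ ^ 2)))
      (Real.sin (t * ξ) * (ξ * Real.exp (-β * ξ ^ 2)) -
        t / (2 * β) * (Real.cos (t * ξ) * Real.exp (-β * ξ ^ 2))) ξ := by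
    have h1 : HasDerivAt (fun ξ ↦ Real.sin (t * ξ)) (Real.cos (t * ξ) * (t * 1)) ξ :=
      ((hasDerivAt_id ξ).const_mul t).sin
    have h2 : HasDerivAt (fun ξ ↦ Real.exp (-β * ξ ^ 2))
        (Real.exp (-β * ξ ^ 2) * (-β * (2 * ξ))) ξ := by
      simpa using (((hasDerivAt_pow 2 ξ).const_mul (-β)).exp)
    refine ((h1.mul h2).const_mul (-(1 / (2 * β)))).congr_deriv ?_
    field_simp
    ring
  have htend : Tendsto (fun ξ ↦ -(1 / (2 * β)) * (Real.sin (t * ξ) * Real.exp (-β * ξ ^ 2)))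
      atTop (𝓝 0) := by
    have he : Tendsto (fun ξ : ℝ ↦ Real.exp (-β * ξ ^ 2)) atTop (𝓝 0) :=
      Real.tendsto_exp_atBot.comp
        ((tendsto_pow_atTop two_ne_zero).const_mul_atTop_of_neg (neg_lt_zero.2 hβ))
    have hb : Tendsto (fun ξ ↦ Real.sin (t * ξ) * Real.exp (-β * ξ ^ 2)) atTop (𝓝 0) :=
      squeeze_zero_norm (fun ξ ↦ by
        rw [norm_mul, Real.norm_of_nonneg (Real.exp_pos _).le]
        exact mul_le_of_le_one_left (Real.exp_pos _).le (Real.abs_sin_le_one _)) he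
    simpa using hb.const_mul (-(1 / (2 * β)))
  have h := integral_Ioi_of_hasDerivAt_of_tendsto' (a := 0) (fun ξ _ ↦ hderiv ξ)
    (hsin.sub hcos) htend
  rw [integral_sub hsin hcos, integral_const_mul, integral_cos_mul_gaussian hβ] at h
  simp only [mul_zero, Real.sin_zero, zero_mul, sub_zero] at h
  linarith

theorem sqrt_two_div_pi_mul (b : ℝ) :
    √(2 / π) * (√(π / (Real.exp (2 * b) / 2)) / 2) = Real.exp (-b) := by
  rw [mul_div_assoc', ← Real.sqrt_mul (by positivity),
    show 2 / π * (π / (Real.exp (2 * b) / 2)) = (2 * Real.exp (-b)) ^ 2 by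
      rw [mul_pow, ← Real.exp_nat_mul, div_div_eq_mul_div, Nat.cast_ofNat,
        show 2 * -b = -(2 * b) by ring, Real.exp_neg]
      field_simp,
    Real.sqrt_sq (by positivity)]
  ring

theorem neg_sq_div_four_mul (b t : ℝ) :
    -t ^ 2 / (4 * (Real.exp (2 * b) / 2)) = -(Real.exp (2 * -b) / 2) * t ^ 2 := by
  rw [show 2 * -b = -(2 * b) by ring, Real.exp_neg]
  field_simp
  ring

theorem kernelTransform_cosine_profile (b : ℝ) {t : ℝ} (ht : 0 < t) :
    kernelTransform cosineKernel (fun ξ ↦ (gaussianProfile (1 / 4) b ξ : ℂ)) t =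
      gaussianProfile (1 / 4) (-b) t := by
  have hβ : 0 < Real.exp (2 * b) / 2 := by positivity
  have h : kernelTransform cosineKernel (fun ξ ↦ (gaussianProfile (1 / 4) b ξ : ℂ)) t =
      ((∫ ξ in Ioi (0 : ℝ), √(2 / π) * Real.exp (b / 2) *
        (Real.cos (t * ξ) * Real.exp (-(Real.exp (2 * b) / 2) * ξ ^ 2)) : ℝ) : ℂ) := by
    rw [kernelTransform, ← integral_complex_ofReal]
    refine setIntegral_congr_fun measurableSet_Ioi fun ξ hξ ↦ ?_
    simp only [cosineKernel]
    rw [gaussianProfile_eq _ _ hξ, ← Complex.ofReal_mul,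
      show (2 * (1 / 4) - 1 / 2 : ℝ) = 0 by norm_num,
      Real.rpow_zero, show 2 * (1 / 4) * b = b / 2 by ring]
    congr 1
    ring
  rw [h, integral_const_mul, integral_cos_mul_gaussian hβ, neg_sq_div_four_mul,
    gaussianProfile_eq _ _ ht, show (2 * (1 / 4) - 1 / 2 : ℝ) = 0 by norm_num, Real.rpow_zero]
  congr 1
  have hs := sqrt_two_div_pi_mul b
  calc _ = (√(2 / π) * (√(π / (Real.exp (2 * b) / 2)) / 2)) * Real.exp (b / 2) *
        Real.exp (-(Real.exp (2 * -b) / 2) * t ^ 2) := by ring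
    _ = _ := by
      rw [hs, ← Real.exp_add, one_mul]
      congr 2
      ring

theorem kernelTransform_sine_profile (b : ℝ) {t : ℝ} (ht : 0 < t) :
    kernelTransform sineKernel (fun ξ ↦ (gaussianProfile (3 / 4) b ξ : ℂ)) t =
      gaussianProfile (3 / 4) (-b) t := by
  have hβ : 0 < Real.exp (2 * b) / 2 := by positivity
  have h : kernelTransform sineKernel (fun ξ ↦ (gaussianProfile (3 / 4) b ξ : ℂ)) t =
      ((∫ ξ in Ioi (0 : ℝ), √(2 / π) * Real.exp (3 / 2 * b) *
        (Real.sin (t * ξ) * (ξ * Real.exp (-(Real.exp (2 * b) / 2) * ξ ^ 2))) : ℝ) : ℂ) := by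
    rw [kernelTransform, ← integral_complex_ofReal]
    refine setIntegral_congr_fun measurableSet_Ioi fun ξ hξ ↦ ?_
    simp only [sineKernel]
    rw [gaussianProfile_eq _ _ hξ, ← Complex.ofReal_mul,
      show (2 * (3 / 4) - 1 / 2 : ℝ) = 1 by norm_num,
      Real.rpow_one, show 2 * (3 / 4) * b = 3 / 2 * b by ring]
    congr 1
    ring
  rw [h, integral_const_mul, integral_sin_mul_gaussian hβ, neg_sq_div_four_mul,
    gaussianProfile_eq _ _ ht, show (2 * (3 / 4) - 1 / 2 : ℝ) = 1 by norm_num, Real.rpow_one]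
  congr 1
  have hs := sqrt_two_div_pi_mul b
  have hb : t / (2 * (Real.exp (2 * b) / 2)) = t * Real.exp (-(2 * b)) := by
    rw [Real.exp_neg]; field_simp
  calc _ = (√(2 / π) * (√(π / (Real.exp (2 * b) / 2)) / 2)) *
        (t / (2 * (Real.exp (2 * b) / 2))) * Real.exp (3 / 2 * b) *
        Real.exp (-(Real.exp (2 * -b) / 2) * t ^ 2) := by ring
    _ = Real.exp (-b) * Real.exp (-(2 * b)) * Real.exp (3 / 2 * b) *
        (t * Real.exp (-(Real.exp (2 * -b) / 2) * t ^ 2)) := by rw [hs, hb]; ring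
    _ = _ := by
      rw [← Real.exp_add, ← Real.exp_add]
      congr 2
      ring

/-- If the integral transform with kernel `k` reflects the Gaussian profiles in their parameter,
then so does its extension to `L²(ℝ₊)`. -/
theorem IsIsometricExtension.apply_profileLp {k : ℝ → ℝ → ℂ} {K : L2HalfLine →L[ℂ] L2HalfLine}
    (hK : IsIsometricExtension k K) {ν : ℝ} (hν : 0 < ν) (b : ℝ)
    (h : ∀ t, 0 < t → kernelTransform k (fun ξ ↦ (gaussianProfile ν b ξ : ℂ)) t =
      gaussianProfile ν (-b) t) :
    K (profileLp hν b) = profileLp hν (-b) := by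
  refine Lp.ext ((hK.apply_toLp (integrable_gaussianProfile hν b).ofReal _).trans ?_)
  filter_upwards [ae_restrict_mem measurableSet_Ioi, (memLp_gaussianProfile hν (-b)).coeFn_toLp]
    with t ht h1
  rw [profileLp, h1]
  exact h t ht

/-! ### Totality of the test functions and the ranges -/

theorem norm_apply_of_isIsometricExtension {k : ℝ → ℝ → ℂ} {A : L2HalfLine →L[ℂ] L2HalfLine}
    (hA : IsIsometricExtension k A) (x : L2HalfLine) : ‖A x‖ = ‖x‖ := by
  simpa using hA.1.dist_eq x 0

theorem isIsometricExtension_isometricExtension {k : ℝ → ℝ → ℂ}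
    (h : ∃! A, IsIsometricExtension k A) : IsIsometricExtension k (isometricExtension k) := by
  rw [isometricExtension, dif_pos h.exists]
  exact h.exists.choose_spec

/-- The test functions `|Γ| k(b, ·)` are total in `L²(ℝ₊)` when the transform with the real kernel
`k` extends to an isometry: a vector `φ` orthogonal to all of them satisfies `K (|Γ| φ) = 0`. -/
theorem eq_zero_of_inner_test {k : ℝ → ℝ → ℂ} {K : L2HalfLine →L[ℂ] L2HalfLine}
    (hK : IsIsometricExtension k K) {ν : ℝ} (hν : 0 < ν) {r : ℝ → ℝ → ℝ}
    (hr : ∀ b τ, k b τ = r b τ)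
    (hmem : ∀ b, MemLp (fun τ ↦ (gammaModulus ν τ : ℂ) * k b τ) 2 halfLineMeasure)
    {φ : L2HalfLine} (hφ : ∀ b, inner ℂ ((hmem b).toLp _) φ = 0) : φ = 0 := by
  have hΓ : MemLp (fun τ ↦ (gammaModulus ν τ : ℂ)) 2 halfLineMeasure :=
    (memLp_two_gammaModulus hν).ofReal.restrict _
  have h1 := integrable_ofReal_mul_Lp hΓ φ
  have h2 : MemLp (fun τ ↦ (gammaModulus ν τ : ℂ) * φ τ) 2 halfLineMeasure := by
    refine MemLp.of_le_mul (c := Real.Gamma ν) (Lp.memLp φ) (hΓ.1.mul (Lp.memLp φ).1)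
      (Eventually.of_forall fun τ ↦ ?_)
    rw [norm_mul, Complex.norm_real, Real.norm_of_nonneg (gammaModulus_pos hν τ).le]
    exact mul_le_mul_of_nonneg_right (gammaModulus_le hν τ) (norm_nonneg _)
  have hzero : K (h2.toLp _) = 0 := by
    refine Lp.ext ((hK.apply_toLp h1 h2).trans ?_)
    filter_upwards [Lp.coeFn_zero ℂ 2 halfLineMeasure] with b h0
    rw [h0, Pi.zero_apply, ← hφ b, L2.inner_def]
    refine integral_congr_ae ?_
    filter_upwards [(hmem b).coeFn_toLp] with τ hτ
    rw [hτ, RCLike.inner_apply, hr, map_mul, Complex.conj_ofReal, Complex.conj_ofReal]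
    ring
  have hn := norm_apply_of_isIsometricExtension hK (h2.toLp _)
  rw [hzero, norm_zero, eq_comm, norm_eq_zero] at hn
  have hae := h2.coeFn_toLp
  rw [hn] at hae
  refine Lp.ext ?_
  filter_upwards [hae, Lp.coeFn_zero ℂ 2 halfLineMeasure] with τ h h0
  rw [h0] at h ⊢
  have hpos : (gammaModulus ν τ : ℂ) ≠ 0 := by exact_mod_cast (gammaModulus_pos hν τ).ne'
  exact (mul_eq_zero.1 h.symm).resolve_left hpos

theorem eq_of_eqOn_of_total {E F : Type*} [NormedAddCommGroup E] [InnerProductSpace ℂ E]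
    [CompleteSpace E] [NormedAddCommGroup F] [NormedSpace ℂ F] {A B : E →L[ℂ] F} {ι : Type*}
    {e : ι → E} (he : ∀ x, (∀ i, inner ℂ (e i) x = 0) → x = 0) (h : ∀ i, A (e i) = B (e i)) :
    A = B := by
  refine ContinuousLinearMap.ext_on (s := range e) ?_ (by rintro _ ⟨i, rfl⟩; exact h i)
  have : (Submodule.span ℂ (range e))ᗮ = ⊥ := by
    refine (Submodule.eq_bot_iff _).2 fun x hx ↦ he x fun i ↦ ?_
    exact (Submodule.mem_orthogonal _ _).1 hx _ (Submodule.subset_span ⟨i, rfl⟩)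
  exact Submodule.dense_iff_topologicalClosure_eq_top.2
    (Submodule.topologicalClosure_eq_top_iff.2 this)

/-- Let `K`, `P`, `M` be isometries of a Hilbert space with `K P = P` and `K M = -M`, such that the
ranges of `P` and `M` are together total. Then these ranges are the eigenspaces of `K`. -/
theorem range_eq_eigenspace {E : Type*} [NormedAddCommGroup E] [InnerProductSpace ℂ E]
    [CompleteSpace E] {K P M : E →L[ℂ] E} {μ : ℂ} (hμ : μ = 1 ∨ μ = -1) (hK : ∀ x, ‖K x‖ = ‖x‖)
    (hP : ∀ x, ‖P x‖ = ‖x‖) (hKP : ∀ x, K (P x) = μ • P x) (hKM : ∀ x, K (M x) = -(μ • M x))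
    (htotal : ∀ x, (∀ y, inner ℂ (P y) x = 0) → (∀ y, inner ℂ (M y) x = 0) → x = 0) :
    LinearMap.range (P : E →ₗ[ℂ] E) = Module.End.eigenspace (K : E →ₗ[ℂ] E) μ := by
  have hinner (x y : E) : inner ℂ (K x) (K y) = inner ℂ x y :=
    LinearIsometry.inner_map_map ⟨(K : E →ₗ[ℂ] E), hK⟩ x y
  have hclosed : IsClosed (LinearMap.range (P : E →ₗ[ℂ] E) : Set E) := by
    have : Isometry P := AddMonoidHomClass.isometry_of_norm P hP
    rw [LinearMap.coe_range]
    exact this.isClosedEmbedding.isClosed_range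
  have : CompleteSpace (LinearMap.range (P : E →ₗ[ℂ] E)) := hclosed.completeSpace_coe
  apply le_antisymm
  · rintro _ ⟨y, rfl⟩
    exact Module.End.mem_eigenspace_iff.2 (hKP y)
  · intro x hx
    have hx : K x = μ • x := Module.End.mem_eigenspace_iff.1 hx
    obtain ⟨_, ⟨y, rfl⟩, v, hv, rfl⟩ :=
      Submodule.exists_add_mem_mem_orthogonal (K := LinearMap.range (P : E →ₗ[ℂ] E)) x
    simp only [ContinuousLinearMap.coe_coe] at hx hv ⊢
    rw [map_add, hKP, smul_add, add_right_inj] at hx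
    suffices v = 0 by
      rw [this, add_zero]
      exact ⟨y, rfl⟩
    refine htotal v (fun z ↦ (Submodule.mem_orthogonal _ _).1 hv _ ⟨z, rfl⟩) fun z ↦ ?_
    have h := hinner (M z) v
    rw [hKM, hx, inner_neg_left, inner_smul_left, inner_smul_right] at h
    have hμ' : (starRingEnd ℂ) μ * μ = 1 := by rcases hμ with rfl | rfl <;> simp
    rw [← mul_assoc, hμ', one_mul, neg_eq_self] at h
    exact h

/-- The common form of the cosine case (`ν = 1/4`) and of the sine case (`ν = 3/4`). -/
theorem ranges_eq_eigensubspaces {ν : ℝ} (hν : 0 < ν) {k kP kM : ℝ → ℝ → ℂ}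
    {K P M : L2HalfLine →L[ℂ] L2HalfLine} (hK : IsIsometricExtension k K)
    (hP : IsIsometricExtension kP P) (hM : IsIsometricExtension kM M)
    (hk : ∀ b t, 0 < t → kernelTransform k (fun ξ ↦ (gaussianProfile ν b ξ : ℂ)) t =
      gaussianProfile ν (-b) t)
    (hkP : IsFoldedFourierKernel kP mellinAmplitude Real.log (mellinPhase ν))
    (hkM : IsFoldedFourierKernel kM mellinAmplitude Real.log (signedMellinPhase ν)) :
    operatorRange P = eigensubspace K 1 ∧ operatorRange M = eigensubspace K (-1) := by
  have hprofile (b : ℝ) : K (profileLp hν b) = profileLp hν (-b) :=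
    hK.apply_profileLp hν b (hk b)
  have hPtest (b : ℝ) := transformPlus_cosineTest hν hkP hP b
  have hMtest (b : ℝ) := transformMinus_sineTest hν hkM hM b
  have hKP : K.comp P = P := by
    refine eq_of_eqOn_of_total (e := cosineTest hν) (fun φ hφ ↦ ?_) fun b ↦ ?_
    · exact eq_zero_of_inner_test (isIsometricExtension_isometricExtension existsUnique_cosine) hν
        (fun _ _ ↦ rfl) _ hφ
    · rw [ContinuousLinearMap.comp_apply, hPtest, map_smul, map_add, hprofile, hprofile, neg_neg,
        add_comm]
  have hKM : K.comp M = -M := by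
    refine eq_of_eqOn_of_total (e := sineTest hν) (fun φ hφ ↦ ?_) fun b ↦ ?_
    · exact eq_zero_of_inner_test (isIsometricExtension_isometricExtension existsUnique_sine) hν
        (fun _ _ ↦ rfl) _ hφ
    · rw [ContinuousLinearMap.comp_apply, neg_apply, hMtest, map_smul, map_sub,
        hprofile, hprofile, neg_neg, ← smul_neg, neg_sub]
  have hKP' (x) : K (P x) = P x := DFunLike.congr_fun hKP x
  have hKM' (x) : K (M x) = -M x := DFunLike.congr_fun hKM x
  have hc : (profileConst ν : ℂ) ≠ 0 := by exact_mod_cast (profileConst_pos ν).ne'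
  have htotal (x : L2HalfLine) (h1 : ∀ y, inner ℂ (P y) x = 0) (h2 : ∀ y, inner ℂ (M y) x = 0) :
      x = 0 := by
    refine eq_zero_of_inner_profileLp hν fun b ↦ ?_
    have e1 := h1 (cosineTest hν b)
    have e2 := h2 (sineTest hν b)
    rw [hPtest, inner_smul_left, Complex.conj_ofReal, inner_add_left, mul_eq_zero] at e1
    rw [hMtest, inner_smul_left, Complex.conj_ofReal, inner_sub_left, mul_eq_zero] at e2
    have e1 := e1.resolve_left hc
    have e2 := e2.resolve_left hc
    linear_combination (e1 + e2) / 2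
  have nK := norm_apply_of_isIsometricExtension hK
  refine ⟨range_eq_eigenspace (M := M) (Or.inl rfl) nK (norm_apply_of_isIsometricExtension hP)
    (by simpa using hKP') (by simpa using hKM') htotal,
    range_eq_eigenspace (M := P) (Or.inr rfl) nK (norm_apply_of_isIsometricExtension hM)
    (by simpa using hKM') (by simpa using hKP') fun x h1 h2 ↦ htotal x h2 h1⟩

theorem isFoldedFourierKernel_eCPlus :
    IsFoldedFourierKernel eCPlus mellinAmplitude Real.log (mellinPhase (1 / 4)) :=
  isFoldedFourierKernel_log fun _ _ _ _ ↦ by rw [eCPlus, phaseC_eq]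

theorem isFoldedFourierKernel_eSPlus :
    IsFoldedFourierKernel eSPlus mellinAmplitude Real.log (mellinPhase (3 / 4)) :=
  isFoldedFourierKernel_log fun _ _ _ _ ↦ by rw [eSPlus, phaseS_eq]

theorem isFoldedFourierKernel_eCMinus :
    IsFoldedFourierKernel eCMinus mellinAmplitude Real.log (signedMellinPhase (1 / 4)) :=
  isFoldedFourierKernel_minus fun _ _ ↦ by rw [eCMinus, phaseC_eq]

theorem isFoldedFourierKernel_eSMinus :
    IsFoldedFourierKernel eSMinus mellinAmplitude Real.log (signedMellinPhase (3 / 4)) :=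
  isFoldedFourierKernel_minus fun _ _ ↦ by rw [eSMinus, phaseS_eq]

theorem existsUnique_plus {ν : ℝ} (hν : 0 < ν) {k : ℝ → ℝ → ℂ}
    (hk : IsFoldedFourierKernel k mellinAmplitude Real.log (mellinPhase ν)) :
    ∃! B, IsIsometricExtension k B :=
  existsUnique_of_fold_log hk (measurable_mellinPhase hν) (norm_mellinPhase hν)

theorem existsUnique_minus {ν : ℝ} (hν : 0 < ν) {k : ℝ → ℝ → ℂ}
    (hk : IsFoldedFourierKernel k mellinAmplitude Real.log (signedMellinPhase ν)) :
    ∃! B, IsIsometricExtension k B :=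
  existsUnique_of_fold_log hk (measurable_signedMellinPhase hν) (norm_signedMellinPhase hν)


end

/-- The first six clauses say that the cosine and sine transforms and the four operators
`T_c^±`, `T_s^±` are well defined: the integral transforms on `L¹ ∩ L²` have exactly one
isometric extension to `L²(ℝ₊)`. The last four identify the ranges. -/
theorem theorem3 :
    ((∃! A, IsIsometricExtension cosineKernel A) ∧
      (∃! A, IsIsometricExtension sineKernel A) ∧
      (∃! A, IsIsometricExtension eCPlus A) ∧
      (∃! A, IsIsometricExtension eCMinus A) ∧
      (∃! A, IsIsometricExtension eSPlus A) ∧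
      (∃! A, IsIsometricExtension eSMinus A)) ∧
    operatorRange transformCPlus = eigensubspace cosineTransform 1 ∧
    operatorRange transformCMinus = eigensubspace cosineTransform (-1) ∧
    operatorRange transformSPlus = eigensubspace sineTransform 1 ∧
    operatorRange transformSMinus = eigensubspace sineTransform (-1) := by
  have h14 : (0 : ℝ) < 1 / 4 := by norm_num
  have h34 : (0 : ℝ) < 3 / 4 := by norm_num
  have eC := existsUnique_cosine
  have eS := existsUnique_sine
  have eCP := existsUnique_plus h14 isFoldedFourierKernel_eCPlus
  have eCM := existsUnique_minus h14 isFoldedFourierKernel_eCMinus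
  have eSP := existsUnique_plus h34 isFoldedFourierKernel_eSPlus
  have eSM := existsUnique_minus h34 isFoldedFourierKernel_eSMinus
  have hC := ranges_eq_eigensubspaces h14 (isIsometricExtension_isometricExtension eC)
    (isIsometricExtension_isometricExtension eCP) (isIsometricExtension_isometricExtension eCM)
    (fun b _ ht ↦ kernelTransform_cosine_profile b ht) isFoldedFourierKernel_eCPlus
    isFoldedFourierKernel_eCMinus
  have hS := ranges_eq_eigensubspaces h34 (isIsometricExtension_isometricExtension eS)
    (isIsometricExtension_isometricExtension eSP) (isIsometricExtension_isometricExtension eSM)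
    (fun b _ ht ↦ kernelTransform_sine_profile b ht) isFoldedFourierKernel_eSPlus
    isFoldedFourierKernel_eSMinus
  exact ⟨⟨eC, eS, eCP, eCM, eSP, eSM⟩, hC.1, hC.2, hS.1, hS.2⟩
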